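/- Let $\Bbbk$ be a field of characteristic zero, let $t,a,b,d,k,\ell,p,q\in\Bbbk$, and let $V$ be the vector space with basis $x_1,x_2,x_3$ and braiding $c(x_i\otimes x_j)=\sum_{m,n\in\{1,2,3\}} r^{ij}_{mn}\,x_m\otimes x_n$, where $r^{ij}_{mn}$ is the entry in row $mn$ and column $ij$ of the matrix $$\mathfrak R_{1,7}=\left(\begin{array}{ccc|ccc|ccc} t & tk & tp & -tk & -tk\ell & td & ta & t(k(a-q)-d) & tb\\ 0 & t & 0 & 0 & -t\ell & t(p-q) & 0 & ta & 0\\ 0 & 0 & t & 0 & 0 & -tk & 0 & 0 & ta\\ \hline 0 & 0 & 0 & t & t\ell & tq & 0 & 0 & 0\\ 0 & 0 & 0 & 0 & t & 0 & 0 & 0 & 0\\ 0 & 0 & 0 & 0 & 0 & t & 0 & 0 & 0\\ \hline 0 & 0 & 0 & 0 & 0 & 0 & t & tk & tp\\ 0 & 0 & 0 & 0 & 0 & 0 & 0 & t & 0\\ 0 & 0 & 0 & 0 & 0 & 0 & 0 & 0 & t \end{array}\right),$$ whose rows are indexed by $11,12,13,21,22,23,31,32,33$ and whose columns are indexed by $11,21,31,12,22,32,13,23,33$.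 Let $\mathfrak B(V)=T(V)/\mathcal J(V)$ be the Nichols algebra of $(V,c)$, where $\mathcal J(V)$ is the largest homogeneous Hopf ideal, generated by homogeneous elements of degree $\ge 2$, of the braided Hopf algebra $T(V)$ in which the elements of $V$ are primitive. Then: (a) If $t=1$ and $a=p-2q$, then $$\mathcal J(V)=\langle x_2x_1-x_1x_2-k\,x_1^2,\ x_3x_1-x_1x_3-q\,x_1^2,\ x_3x_2-x_2x_3+k\,x_1x_3-q\,x_1x_2-(d+qk)\,x_1^2\rangle,$$ $B_3=\{x_1^{a_1}x_2^{a_2}x_3^{a_3}: a_i\ge 0\}$ is a basis of $\mathfrak B(V)$, and $\operatorname{GKdim}\mathfrak B(V)=3$. (b) If $t=-1$, $a=-p$ and $b\neq -p^2$, then $$\mathcal J(V)=\langle x_2x_1+x_1x_2,\ x_3x_1+x_1x_3,\ x_3x_2+x_2x_3-k\,x_1x_3-q\,x_1x_2,\ x_1^2,\ x_2^2-\ell\,x_1x_2\rangle,$$ $B_1=\{x_1^{a_1}x_2^{a_2}x_3^{a_3}: a_i\ge 0;\ a_1,a_2<2\}$ is a basis of $\mathfrak B(V)$, and $\operatorname{GKdim}\mathfrak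 B(V)=1$. (c) If $t=-1$, $a=-p$ and $b=-p^2$, then $$\mathcal J(V)=\langle x_2x_1+x_1x_2,\ x_3x_1+x_1x_3,\ x_3x_2+x_2x_3-k\,x_1x_3-q\,x_1x_2,\ x_1^2,\ x_2^2-\ell\,x_1x_2,\ x_3^2-p\,x_1x_3\rangle,$$ $B_0=\{x_1^{a_1}x_2^{a_2}x_3^{a_3}: 0\le a_i<2\}$ is a basis of $\mathfrak B(V)$, $\operatorname{GKdim}\mathfrak B(V)=0$ and $\dim\mathfrak B(V)=8$. -/

import Mathlib

open scoped TensorProduct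

noncomputable section

/-! ### Nichols algebras of braided vector spaces with a chosen basis

`X` is a finite set indexing a basis `(x_i)` of a vector space `V` over `𝕜`.  A map
`c : V ⊗ V → V ⊗ V` is given by its coefficients `r`, where `r i j m n` is the coefficient of
`x_m ⊗ x_n` in `c (x_i ⊗ x_j)`.  The tensor algebra `T(V)` is `FreeAlgebra 𝕜 X`. -/

namespace Nichols

variable {𝕜 : Type*} [Field 𝕜] {X : Type*} [Fintype X] [DecidableEq X]

/-- The extended braiding `c : V ⊗ T(V) → T(V) ⊗ V`, written as
`c (x_i ⊗ f) = ∑ l, (braidMatrix r f) i l ⊗ x_l`.  On generators it is `c`; the hexagon rule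
`c_{V, U ⊗ W} = (id_U ⊗ c_{V, W}) (c_{V, U} ⊗ id_W)` says that `f ↦ braidMatrix r f` is
multiplicative. -/
def braidMatrix (r : X → X → X → X → 𝕜) :
    FreeAlgebra 𝕜 X →ₐ[𝕜] Matrix X X (FreeAlgebra 𝕜 X) :=
  FreeAlgebra.lift 𝕜 fun j => Matrix.of fun i l => ∑ m, r i j m l • FreeAlgebra.ι 𝕜 m

/-- The `(i, l)` entry of `braidMatrix r`, as a linear endomorphism of `T(V)`. -/
def braidEntry (r : X → X → X → X → 𝕜) (i l : X) :
    FreeAlgebra 𝕜 X →ₗ[𝕜] FreeAlgebra 𝕜 X where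
  toFun f := braidMatrix r f i l
  map_add' f g := by simp
  map_smul' s f := by simp

/-- Left multiplication by `Δ (x_i) = x_i ⊗ 1 + 1 ⊗ x_i` in the braided tensor product algebra
`T(V) ⊗ T(V)`, whose product is `(mul ⊗ mul) (id ⊗ c ⊗ id)`:
`a ⊗ b ↦ x_i a ⊗ b + ∑ l, (braidMatrix r a) i l ⊗ x_l b`. -/
def comulStep (r : X → X → X → X → 𝕜) (i : X) :
    Module.End 𝕜 (FreeAlgebra 𝕜 X ⊗[𝕜] FreeAlgebra 𝕜 X) :=
  TensorProduct.map (LinearMap.mulLeft 𝕜 (FreeAlgebra.ι 𝕜 i)) LinearMap.id +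
    ∑ l, TensorProduct.map (braidEntry r i l) (LinearMap.mulLeft 𝕜 (FreeAlgebra.ι 𝕜 l))

/-- The braided comultiplication `Δ` of `T(V)`: the multiplicative map into the braided tensor
product algebra `T(V) ⊗ T(V)` for which the `x_i` are primitive, so that
`Δ (x_{i₁} ⋯ x_{iₙ}) = Δ (x_{i₁}) ⋯ Δ (x_{iₙ}) (1 ⊗ 1)`. -/
def comul (r : X → X → X → X → 𝕜) :
    FreeAlgebra 𝕜 X →ₗ[𝕜] FreeAlgebra 𝕜 X ⊗[𝕜] FreeAlgebra 𝕜 X where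
  toFun f := FreeAlgebra.lift 𝕜 (comulStep r) f (1 ⊗ₜ[𝕜] 1)
  map_add' f g := by simp
  map_smul' s f := by simp

/-- `g ↦ mul (c (S (x_i) ⊗ g)) = - ∑ l, (braidMatrix r g) i l * x_l`, where `S (x_i) = - x_i`. -/
def antipodeStep (r : X → X → X → X → 𝕜) (i : X) : Module.End 𝕜 (FreeAlgebra 𝕜 X) :=
  -∑ l, LinearMap.mulRight 𝕜 (FreeAlgebra.ι 𝕜 l) ∘ₗ braidEntry r i l

/-- The antipode `S` of the braided Hopf algebra `T(V)`: `S 1 = 1`, `S (x_i) = - x_i` and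
`S (x_i f) = mul (c (S (x_i) ⊗ S f))`. -/
def antipode (r : X → X → X → X → 𝕜) : FreeAlgebra 𝕜 X →ₗ[𝕜] FreeAlgebra 𝕜 X where
  toFun f := FreeAlgebra.lift 𝕜 (antipodeStep r) f 1
  map_add' f g := by simp
  map_smul' s f := by simp

variable (𝕜 X) in
/-- The homogeneous component `Tⁿ(V)` of the tensor algebra. -/
def degreePart (n : ℕ) : Submodule 𝕜 (FreeAlgebra 𝕜 X) :=
  Submodule.span 𝕜 (Set.range (FreeAlgebra.ι 𝕜 (X := X))) ^ n

/-- A homogeneous Hopf ideal of `T(V)` generated by homogeneous elements of degree `≥ 2`.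
The counit kills such an ideal automatically, as it kills every element of positive degree. -/
structure IsHopfIdeal (r : X → X → X → X → 𝕜) (I : TwoSidedIdeal (FreeAlgebra 𝕜 X)) :
    Prop where
  generated : ∃ S : Set (FreeAlgebra 𝕜 X),
    (∀ s ∈ S, ∃ n, 2 ≤ n ∧ s ∈ degreePart 𝕜 X n) ∧ I = TwoSidedIdeal.span S
  /-- `Δ(I) ⊆ I ⊗ T(V) + T(V) ⊗ I` -/
  comul_mem : ∀ f ∈ I, comul r f ∈
    Submodule.span 𝕜 {z | ∃ u v : FreeAlgebra 𝕜 X, (u ∈ I ∨ v ∈ I) ∧ z = u ⊗ₜ[𝕜] v}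
  antipode_mem : ∀ f ∈ I, antipode r f ∈ I

/-- The defining ideal `𝒥(V)` of the Nichols algebra: the largest homogeneous Hopf ideal of `T(V)`
generated by homogeneous elements of degree `≥ 2`. -/
def nicholsIdeal (r : X → X → X → X → 𝕜) : TwoSidedIdeal (FreeAlgebra 𝕜 X) :=
  sSup {I | IsHopfIdeal r I}

/-- Every element of a supremum of ideals is reached by sums of elements of the ideals. -/
theorem sSup_ideal_induction {R : Type*} [Ring R] {S : Set (TwoSidedIdeal R)} {P : R → Prop}
    (hmem : ∀ I ∈ S, ∀ f ∈ I, P f) (hzero : P 0) (hadd : ∀ f g, P f → P g → P (f + g))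
    {f : R} (hf : f ∈ sSup S) : P f := by
  let A : AddSubmonoid R := ⨆ I ∈ S, (TwoSidedIdeal.asIdeal I).toAddSubmonoid
  have hsub : ∀ I ∈ S, ∀ x ∈ I, x ∈ A := fun I hI x hx =>
    AddSubmonoid.mem_iSup_of_mem I (AddSubmonoid.mem_iSup_of_mem hI hx)
  have ind : ∀ (Q : R → Prop), (∀ I ∈ S, ∀ f ∈ I, Q f) → Q 0 →
      (∀ f g, Q f → Q g → Q (f + g)) → ∀ x ∈ A, Q x := by
    intro Q h1 h2 h3 x hx
    let B : AddSubmonoid R :=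
      { carrier := {y | Q y}, add_mem' := fun {a b} ha hb => h3 a b ha hb, zero_mem' := h2 }
    have hAB : A ≤ B := iSup₂_le fun I hI y hy => h1 I hI y hy
    exact hAB hx
  let K : TwoSidedIdeal R := TwoSidedIdeal.mk' {x | x ∈ A} A.zero_mem
    (fun {x y} hx hy => A.add_mem hx hy)
    (fun {x} hx => ind (fun y => -y ∈ A) (fun I hI y hy => hsub I hI _ (I.neg_mem hy))
      (by simp) (fun f g h1 h2 => by rw [neg_add]; exact A.add_mem h1 h2) x hx)
    (fun {x y} hy => ind (fun z => x * z ∈ A)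
      (fun I hI z hz => hsub I hI _ (I.mul_mem_left _ _ hz))
      (by simp) (fun f g h1 h2 => by rw [mul_add]; exact A.add_mem h1 h2) y hy)
    (fun {x y} hx => ind (fun z => z * y ∈ A)
      (fun I hI z hz => hsub I hI _ (I.mul_mem_right _ _ hz))
      (by simp) (fun f g h1 h2 => by rw [add_mul]; exact A.add_mem h1 h2) x hx)
  have hK : sSup S ≤ K := sSup_le fun I hI x hx => by
    rw [TwoSidedIdeal.mem_mk']; exact hsub I hI x hx
  have := hK hf
  rw [TwoSidedIdeal.mem_mk'] at this
  exact ind P hmem hzero hadd f this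

/-- `nicholsIdeal r` is indeed the greatest ideal of the required kind. -/
theorem nicholsIdeal_isGreatest (r : X → X → X → X → 𝕜) :
    IsGreatest {I | IsHopfIdeal r I} (nicholsIdeal r) := by
  refine ⟨⟨?_, ?_, ?_⟩, fun I hI => le_sSup hI⟩
  · refine ⟨{s | s ∈ nicholsIdeal r ∧ ∃ n, 2 ≤ n ∧ s ∈ degreePart 𝕜 X n}, fun s hs => hs.2,
      le_antisymm (sSup_le fun I hI => ?_) ?_⟩
    · obtain ⟨S, hS, rfl⟩ := hI.generated
      refine TwoSidedIdeal.span_mono fun s hs => ⟨?_, hS s hs⟩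
      exact (le_sSup hI : _ ≤ nicholsIdeal r) (TwoSidedIdeal.subset_span hs)
    · exact TwoSidedIdeal.span_le.2 fun s hs => hs.1
  · intro f hf
    refine sSup_ideal_induction (S := {I | IsHopfIdeal r I})
      (P := fun f => comul r f ∈ Submodule.span 𝕜 {z | ∃ u v : FreeAlgebra 𝕜 X,
        (u ∈ nicholsIdeal r ∨ v ∈ nicholsIdeal r) ∧ z = u ⊗ₜ[𝕜] v})
      (fun I hI f hf => ?_) (by rw [map_zero]; exact Submodule.zero_mem _)
      (fun f g h1 h2 => by rw [map_add]; exact Submodule.add_mem _ h1 h2) hf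
    refine Submodule.span_mono ?_ (hI.comul_mem f hf)
    rintro z ⟨u, v, huv, rfl⟩
    have hle : I ≤ nicholsIdeal r := le_sSup hI
    exact ⟨u, v, huv.imp (fun h => hle h) (fun h => hle h), rfl⟩
  · intro f hf
    refine sSup_ideal_induction (S := {I | IsHopfIdeal r I})
      (P := fun f => antipode r f ∈ nicholsIdeal r) (fun I hI f hf => ?_)
      (by rw [map_zero]; exact TwoSidedIdeal.zero_mem _)
      (fun f g h1 h2 => by rw [map_add]; exact TwoSidedIdeal.add_mem _ h1 h2) hf
    have hle : I ≤ nicholsIdeal r := le_sSup hI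
    exact hle (hI.antipode_mem f hf)

/-- The Nichols algebra `𝔅(V) = T(V) / 𝒥(V)`. -/
abbrev NicholsAlgebra (r : X → X → X → X → 𝕜) : Type _ := (nicholsIdeal r).ringCon.Quotient

/-- The image of `x_i` in the Nichols algebra. -/
def gen (r : X → X → X → X → 𝕜) (i : X) : NicholsAlgebra r :=
  (nicholsIdeal r).ringCon.mk' (FreeAlgebra.ι 𝕜 i)

/-- In rank three: the family `x₁^{e₁} x₂^{e₂} x₃^{e₃}`, `e ∈ E`, is a basis of `𝔅(V)`. -/
def IsMonomialBasis (r : Fin 3 → Fin 3 → Fin 3 → Fin 3 → 𝕜) (E : Set (Fin 3 → ℕ)) : Prop :=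
  ∃ β : Module.Basis E 𝕜 (NicholsAlgebra r),
    ∀ e : E, β e = gen r 0 ^ e.1 0 * gen r 1 ^ e.1 1 * gen r 2 ^ e.1 2

/-- Exponents of the family `B₀`. -/
def expB0 : Set (Fin 3 → ℕ) := {e | ∀ i, e i < 2}

/-- Exponents of the family `B₁`. -/
def expB1 : Set (Fin 3 → ℕ) := {e | e 0 < 2 ∧ e 1 < 2}

/-- Exponents of the family `B₃`. -/
def expB3 : Set (Fin 3 → ℕ) := Set.univ

end Nichols

/-- The Gelfand--Kirillov dimension of a `𝕜`-algebra `A`: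
`sup_W limsup_n log (dim (W⁰ + W¹ + ⋯ + Wⁿ)) / log n`, over the finite-dimensional subspaces `W`
of `A`. -/
def gkDim (𝕜 A : Type*) [Field 𝕜] [Ring A] [Algebra 𝕜 A] : EReal :=
  ⨆ (W : Submodule 𝕜 A) (_ : W.FG),
    Filter.limsup (fun n : ℕ =>
      ((Real.log (Module.finrank 𝕜 (⨆ i ≤ n, W ^ i : Submodule 𝕜 A)) / Real.log n : ℝ) : EReal))
      Filter.atTop

/-! ### The family `ℜ_{1,7}` -/

namespace R17

variable {𝕜 : Type*} [Field 𝕜]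

/-- The matrix `ℜ_{1,7}`.  Rows are indexed by `11, 12, 13, 21, 22, 23, 31, 32, 33` and columns by
`11, 21, 31, 12, 22, 32, 13, 23, 33`. -/
def RMatrix (t a b d k ℓ p q : 𝕜) : Matrix (Fin 9) (Fin 9) 𝕜 :=
  !![t, t*k, t*p, -(t*k), -(t*k*ℓ), t*d,       t*a, t*(k*(a - q) - d), t*b;
     0, t,   0,   0,      -(t*ℓ),   t*(p - q), 0,   t*a,               0;
     0, 0,   t,   0,      0,        -(t*k),    0,   0,                 t*a;
     0, 0,   0,   t,      t*ℓ,      t*q,       0,   0,                 0;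
     0, 0,   0,   0,      t,        0,         0,   0,                 0;
     0, 0,   0,   0,      0,        t,         0,   0,                 0;
     0, 0,   0,   0,      0,        0,         t,   t*k,               t*p;
     0, 0,   0,   0,      0,        0,         0,   t,                 0;
     0, 0,   0,   0,      0,        0,         0,   0,                 t]

/-- The braiding associated with `ℜ_{1,7}`: `c (x_i ⊗ x_j) = ∑ m n, r^{ij}_{mn} x_m ⊗ x_n`, where
`r^{ij}_{mn}` is the entry in row `mn` and column `ij` of the matrix (the indices are `0, 1, 2`
here). -/
def braiding (t a b d k ℓ p q : 𝕜) (i j m n : Fin 3) : 𝕜 :=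
  RMatrix t a b d k ℓ p q ⟨3 * m.1 + n.1, by omega⟩ ⟨i.1 + 3 * j.1, by omega⟩

variable (𝕜) in
/-- The generators of `T(V)`: `x₁ = x 𝕜 0`, `x₂ = x 𝕜 1`, `x₃ = x 𝕜 2`. -/
abbrev x (i : Fin 3) : FreeAlgebra 𝕜 (Fin 3) := FreeAlgebra.ι 𝕜 i

/-- `x₂x₁ - x₁x₂ - k x₁²`, `x₃x₁ - x₁x₃ - q x₁²`,
`x₃x₂ - x₂x₃ + k x₁x₃ - q x₁x₂ - (d + qk) x₁²`. -/
def relA (d k q : 𝕜) : Set (FreeAlgebra 𝕜 (Fin 3)) :=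
  {x 𝕜 1 * x 𝕜 0 - x 𝕜 0 * x 𝕜 1 - k • x 𝕜 0 ^ 2,
   x 𝕜 2 * x 𝕜 0 - x 𝕜 0 * x 𝕜 2 - q • x 𝕜 0 ^ 2,
   x 𝕜 2 * x 𝕜 1 - x 𝕜 1 * x 𝕜 2 + k • (x 𝕜 0 * x 𝕜 2) - q • (x 𝕜 0 * x 𝕜 1)
     - (d + q * k) • x 𝕜 0 ^ 2}

/-- `x₂x₁ + x₁x₂`, `x₃x₁ + x₁x₃`, `x₃x₂ + x₂x₃ - k x₁x₃ - q x₁x₂`, `x₁²`, `x₂² - ℓ x₁x₂`. -/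
def relB (k ℓ q : 𝕜) : Set (FreeAlgebra 𝕜 (Fin 3)) :=
  {x 𝕜 1 * x 𝕜 0 + x 𝕜 0 * x 𝕜 1,
   x 𝕜 2 * x 𝕜 0 + x 𝕜 0 * x 𝕜 2,
   x 𝕜 2 * x 𝕜 1 + x 𝕜 1 * x 𝕜 2 - k • (x 𝕜 0 * x 𝕜 2) - q • (x 𝕜 0 * x 𝕜 1),
   x 𝕜 0 ^ 2,
   x 𝕜 1 ^ 2 - ℓ • (x 𝕜 0 * x 𝕜 1)}

/-- The relations `relB` together with `x₃² - p x₁x₃`. -/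
def relC (k ℓ p q : 𝕜) : Set (FreeAlgebra 𝕜 (Fin 3)) :=
  relB k ℓ q ∪ {x 𝕜 2 ^ 2 - p • (x 𝕜 0 * x 𝕜 2)}

end R17

end

/-
A space of quadratic tensors on which `c` is `-1` and which is braided in `(V, c)` generates a Hopf
ideal `I`, so `I ⊆ 𝒥(V)`.  The relations straighten products of generators, so the ordered monomials
span `T(V) / I`.  In `𝔅(V)` they stay independent, because the braiding never raises the first
index: `∂_j` then commutes with left multiplication by `x_i` for `i < j`, and iterated skew
derivations read off one exponent after another.  Hence `I = 𝒥(V)`, and the Gelfand–Kirillov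
dimension is the growth rate of the set of exponents.  In case (b) the square `x₃²` is not killed:
`z = x₃² - p x₁x₃` has `∂₁² z` a multiple of `b + p²`, which is invertible, so all powers of `z`,
and with them those of `x₃`, survive.
-/

noncomputable section

namespace Nichols

/-! ### Quadratic Hopf ideals -/

section Quadratic

variable {𝕜 : Type*} [Field 𝕜] {X : Type*} [Fintype X]

/-- The element `∑ S i j x_i x_j` of `T²(V)`: matrices are tensors in `V ⊗ V`. -/
def quad : Matrix X X 𝕜 →ₗ[𝕜] FreeAlgebra 𝕜 X where
  toFun S := ∑ i, ∑ j, S i j • (FreeAlgebra.ι 𝕜 i * FreeAlgebra.ι 𝕜 j)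
  map_add' S T := by simp [add_smul, Finset.sum_add_distrib]
  map_smul' s S := by simp [mul_smul, Finset.smul_sum]

theorem quad_apply (S : Matrix X X 𝕜) :
    quad S = ∑ i, ∑ j, S i j • (FreeAlgebra.ι 𝕜 i * FreeAlgebra.ι 𝕜 j) := rfl

theorem quad_mem_degreePart (S : Matrix X X 𝕜) : quad S ∈ degreePart 𝕜 X 2 := by
  rw [quad_apply, degreePart, pow_two]
  exact Submodule.sum_mem _ fun i _ => Submodule.sum_mem _ fun j _ => Submodule.smul_mem _ _ <|
    Submodule.mul_mem_mul (Submodule.subset_span ⟨i, rfl⟩) (Submodule.subset_span ⟨j, rfl⟩)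

theorem lift_quad {A : Type*} [Semiring A] [Algebra 𝕜 A] (F : X → A) (S : Matrix X X 𝕜) :
    FreeAlgebra.lift 𝕜 F (quad S) = ∑ i, ∑ j, S i j • (F i * F j) := by
  simp [quad_apply]

theorem quad_transpose_mul_mul (A S B : Matrix X X 𝕜) :
    quad (A.transpose * S * B) = ∑ j, ∑ j', S j j' •
      ((∑ m, A j m • FreeAlgebra.ι 𝕜 m) * ∑ m, B j' m • FreeAlgebra.ι 𝕜 m) := by
  have reorder (f : X → X → X → X → FreeAlgebra 𝕜 X) :
      ∑ a, ∑ b, ∑ j', ∑ j, f a b j' j = ∑ j, ∑ j', ∑ b, ∑ a, f a b j' j := by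
    simp only [← Finset.sum_product']
    exact Finset.sum_bij' (fun x _ => (x.2.2.2, x.2.2.1, x.2.1, x.1))
      (fun x _ => (x.2.2.2, x.2.2.1, x.2.1, x.1)) (by simp) (by simp) (by simp) (by simp) (by simp)
  simp only [quad_apply, Matrix.mul_apply, Matrix.transpose_apply, Finset.sum_mul, Finset.mul_sum,
    Finset.sum_smul, Finset.smul_sum, smul_mul_assoc, mul_smul_comm, smul_smul]
  rw [reorder]
  exact Finset.sum_congr rfl fun j _ => Finset.sum_congr rfl fun j' _ =>
    Finset.sum_congr rfl fun a _ => Finset.sum_congr rfl fun b _ => by congr 1; ring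

/-- The matrix of `x_j ↦ c (x_i ⊗ x_j)` followed by extraction of the coefficient of `⊗ x_l`. -/
def outerSlice (r : X → X → X → X → 𝕜) (i l : X) : Matrix X X 𝕜 := Matrix.of fun j m => r i j m l

/-- The matrix of `x_i ↦ c (x_i ⊗ x_n)` followed by extraction of the coefficient of `x_m ⊗`. -/
def innerSlice (r : X → X → X → X → 𝕜) (n m : X) : Matrix X X 𝕜 := Matrix.of fun i l => r i n m l

/-- A space `W` of tensors in `V ⊗ V` on which the braiding is `-1` and which is braided in
`(V, c)`, i.e. `c (V ⊗ W) ⊆ W ⊗ V` and `c (W ⊗ V) ⊆ V ⊗ W`, written in coordinates. -/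
structure IsBraidedPrimitive (r : X → X → X → X → 𝕜) (W : Submodule 𝕜 (Matrix X X 𝕜)) : Prop where
  braiding_eq_neg : ∀ S ∈ W, ∀ m n, ∑ i, ∑ j, S i j * r i j m n = -S m n
  outer_mem : ∀ S ∈ W, ∀ i l, ∑ m, (outerSlice r i m).transpose * S * outerSlice r m l ∈ W
  inner_mem : ∀ S ∈ W, ∀ n m, ∑ m', (innerSlice r m' m).transpose * S * innerSlice r n m' ∈ W

variable (W : Submodule 𝕜 (Matrix X X 𝕜))

/-- The two-sided ideal of `T(V)` generated by a space of tensors in `V ⊗ V`. -/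
def quadIdeal : TwoSidedIdeal (FreeAlgebra 𝕜 X) := TwoSidedIdeal.span (quad '' W)

variable {W}

theorem quad_mem_quadIdeal {S : Matrix X X 𝕜} (hS : S ∈ W) : quad S ∈ quadIdeal W :=
  TwoSidedIdeal.subset_span ⟨S, hS, rfl⟩

theorem quadIdeal_span (G : Set (Matrix X X 𝕜)) :
    quadIdeal (Submodule.span 𝕜 G) = TwoSidedIdeal.span (quad '' G) := by
  refine le_antisymm (TwoSidedIdeal.span_le.2 ?_)
    (TwoSidedIdeal.span_mono (Set.image_mono Submodule.subset_span))
  rintro _ ⟨S, hS, rfl⟩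
  have hle : Submodule.span 𝕜 G ≤
      ((TwoSidedIdeal.span (quad '' G)).asIdeal.restrictScalars 𝕜).comap quad :=
    Submodule.span_le.2 fun S hS => TwoSidedIdeal.subset_span ⟨S, hS, rfl⟩
  exact hle hS

theorem IsBraidedPrimitive.sum_smul_mul_add {r : X → X → X → X → 𝕜} (hW : IsBraidedPrimitive r W)
    {S : Matrix X X 𝕜} (hS : S ∈ W) {R : Type*} [Semiring R] [Algebra 𝕜 R] {A B : X → R}
    (exchange : ∀ i j, B i * A j = ∑ m, ∑ n, r i j m n • (A m * B n)) :
    ∑ i, ∑ j, S i j • ((A i + B i) * (A j + B j)) =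
      ∑ i, ∑ j, S i j • (A i * A j) + ∑ i, ∑ j, S i j • (B i * B j) := by
  have cross : ∑ i, ∑ j, S i j • (B i * A j) + ∑ i, ∑ j, S i j • (A i * B j) = 0 := by
    have reorder (f : X → X → X → X → R) :
        ∑ i, ∑ j, ∑ m, ∑ n, f i j m n = ∑ m, ∑ n, ∑ i, ∑ j, f i j m n := by
      simp only [← Finset.sum_product']
      exact Finset.sum_bij' (fun x _ => (x.2.2.1, x.2.2.2, x.1, x.2.1))
        (fun x _ => (x.2.2.1, x.2.2.2, x.1, x.2.1)) (by simp) (by simp) (by simp) (by simp)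
        (by simp)
    simp only [exchange, Finset.smul_sum, smul_smul]
    rw [reorder]
    simp only [← Finset.sum_smul, hW.braiding_eq_neg S hS, ← Finset.sum_add_distrib, ← add_smul,
      neg_add_cancel, zero_smul, Finset.sum_const_zero]
  calc ∑ i, ∑ j, S i j • ((A i + B i) * (A j + B j))
      = ∑ i, ∑ j, S i j • (A i * A j) + ∑ i, ∑ j, S i j • (B i * B j) +
          (∑ i, ∑ j, S i j • (B i * A j) + ∑ i, ∑ j, S i j • (A i * B j)) := by
        simp only [mul_add, add_mul, smul_add, Finset.sum_add_distrib]
        abel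
    _ = _ := by rw [cross, add_zero]

end Quadratic

theorem lift_apply_mem_of_mem_span {𝕜 X M : Type*} [Field 𝕜] [AddCommGroup M] [Module 𝕜 M]
    {K : Submodule 𝕜 M} {F : X → Module.End 𝕜 M} (hF : ∀ i, ∀ v ∈ K, F i v ∈ K)
    {s : Set (FreeAlgebra 𝕜 X)} (hs : ∀ f ∈ s, ∀ v, FreeAlgebra.lift 𝕜 F f v ∈ K)
    {f : FreeAlgebra 𝕜 X} (hf : f ∈ TwoSidedIdeal.span s) (v : M) :
    FreeAlgebra.lift 𝕜 F f v ∈ K := by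
  have stable (a : FreeAlgebra 𝕜 X) : ∀ v ∈ K, FreeAlgebra.lift 𝕜 F a v ∈ K := by
    induction a using FreeAlgebra.induction with
    | grade0 c =>
      intro v hv
      rw [AlgHom.commutes, Module.algebraMap_end_apply]
      exact K.smul_mem _ hv
    | grade1 n => intro v hv; rw [FreeAlgebra.lift_ι_apply]; exact hF n v hv
    | mul a b ha hb => intro v hv; rw [map_mul]; exact ha _ (hb _ hv)
    | add a b ha hb => intro v hv; rw [map_add]; exact K.add_mem (ha _ hv) (hb _ hv)
  let N : TwoSidedIdeal (FreeAlgebra 𝕜 X) :=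
    TwoSidedIdeal.mk' {f | ∀ v, FreeAlgebra.lift 𝕜 F f v ∈ K} (by simp)
      (fun hx hy v => by rw [map_add]; exact K.add_mem (hx v) (hy v))
      (fun hx v => by rw [map_neg]; exact K.neg_mem (hx v))
      (fun {x y} hy v => by rw [map_mul]; exact stable x _ (hy v))
      (fun hx v => by rw [map_mul]; exact hx _)
  have hN : TwoSidedIdeal.span s ≤ N :=
    TwoSidedIdeal.span_le.2 fun f hf => (TwoSidedIdeal.mem_mk' ..).2 (hs f hf)
  exact (TwoSidedIdeal.mem_mk' ..).1 (hN hf) v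

section PairVec

variable {𝕜 : Type*} [Field 𝕜] {X : Type*} (W : Submodule 𝕜 (Matrix X X 𝕜))

/-- A tensor `∑ S i j x_i ⊗ x_j` as a row vector for the matrices `braidPair` below, which index
`x_i ⊗ x_j` by `(j, i)`. -/
def pairVec (S : Matrix X X 𝕜) : X × X → FreeAlgebra 𝕜 X :=
  fun x => algebraMap 𝕜 (FreeAlgebra 𝕜 X) (S x.2 x.1)

/-- The row vectors representing the elements of `T(V) ⊗ W`. -/
def extendScalars : Submodule (FreeAlgebra 𝕜 X) (X × X → FreeAlgebra 𝕜 X) :=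
  Submodule.span _ (pairVec '' W)

variable {W}

theorem pairVec_mem_extendScalars {S : Matrix X X 𝕜} (hS : S ∈ W) : pairVec S ∈ extendScalars W :=
  Submodule.subset_span ⟨S, hS, rfl⟩

/-- The subspace `I ⊗ T(V) + T(V) ⊗ I` of `T(V) ⊗ T(V)`. -/
def tensorIdeal (I : TwoSidedIdeal (FreeAlgebra 𝕜 X)) :
    Submodule 𝕜 (FreeAlgebra 𝕜 X ⊗[𝕜] FreeAlgebra 𝕜 X) :=
  Submodule.span 𝕜 {z | ∃ u v : FreeAlgebra 𝕜 X, (u ∈ I ∨ v ∈ I) ∧ z = u ⊗ₜ[𝕜] v}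

variable [Fintype X]

theorem sum_tmul_quad_mem_tensorIdeal {v : X × X → FreeAlgebra 𝕜 X} (hv : v ∈ extendScalars W)
    (b : FreeAlgebra 𝕜 X) :
    ∑ x, v x ⊗ₜ[𝕜] (FreeAlgebra.ι 𝕜 x.2 * FreeAlgebra.ι 𝕜 x.1 * b) ∈
      tensorIdeal (quadIdeal W) := by
  induction hv using Submodule.closure_induction with
  | zero => simp
  | add v w _ _ hv hw =>
    simp only [Pi.add_apply, TensorProduct.add_tmul, Finset.sum_add_distrib]
    exact Submodule.add_mem _ hv hw
  | smul_mem s v hv =>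
    obtain ⟨S, hS, rfl⟩ := hv
    refine Submodule.subset_span ⟨s, quad S * b,
      Or.inr (TwoSidedIdeal.mul_mem_right _ _ _ (quad_mem_quadIdeal hS)), ?_⟩
    simp only [quad_apply, Finset.sum_mul, TensorProduct.tmul_sum, smul_mul_assoc, Pi.smul_apply,
      pairVec, smul_eq_mul, TensorProduct.tmul_smul, ← Algebra.commutes, ← Algebra.smul_def,
      TensorProduct.smul_tmul', Fintype.sum_prod_type]
    exact Finset.sum_comm

end PairVec

section HopfIdeal

variable {𝕜 : Type*} [Field 𝕜] {X : Type*} [Fintype X] [DecidableEq X]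
  {r : X → X → X → X → 𝕜} {W : Submodule 𝕜 (Matrix X X 𝕜)} {S : Matrix X X 𝕜}

theorem braidMatrix_ι (r : X → X → X → X → 𝕜) (i j l : X) :
    braidMatrix r (FreeAlgebra.ι 𝕜 j) i l = ∑ m, r i j m l • FreeAlgebra.ι 𝕜 m := by
  simp [braidMatrix]

theorem comulStep_tmul (r : X → X → X → X → 𝕜) (i : X) (u v : FreeAlgebra 𝕜 X) :
    comulStep r i (u ⊗ₜ[𝕜] v) = (FreeAlgebra.ι 𝕜 i * u) ⊗ₜ[𝕜] v +
      ∑ l, braidMatrix r u i l ⊗ₜ[𝕜] (FreeAlgebra.ι 𝕜 l * v) := by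
  simp [comulStep, braidEntry]

theorem antipodeStep_apply (r : X → X → X → X → 𝕜) (i : X) (u : FreeAlgebra 𝕜 X) :
    antipodeStep r i u = -∑ l, braidMatrix r u i l * FreeAlgebra.ι 𝕜 l := by
  simp [antipodeStep, braidEntry]

theorem braidMatrix_quad (r : X → X → X → X → 𝕜) (S : Matrix X X 𝕜) (i l : X) :
    braidMatrix r (quad S) i l =
      quad (∑ m, (outerSlice r i m).transpose * S * outerSlice r m l) := by
  have reorder (f : X → X → X → FreeAlgebra 𝕜 X) :
      ∑ m, ∑ j, ∑ j', f m j j' = ∑ j, ∑ j', ∑ m, f m j j' := by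
    rw [Finset.sum_comm]
    exact Finset.sum_congr rfl fun j _ => Finset.sum_comm
  simp only [map_sum, quad_transpose_mul_mul]
  rw [reorder]
  simp only [quad_apply, map_sum, map_smul, map_mul, Matrix.sum_apply, Matrix.smul_apply,
    Matrix.mul_apply, braidMatrix_ι, outerSlice, Matrix.of_apply, Finset.smul_sum]

theorem IsBraidedPrimitive.braidMatrix_mem (hW : IsBraidedPrimitive r W) {f : FreeAlgebra 𝕜 X}
    (hf : f ∈ quadIdeal W) (i l : X) : braidMatrix r f i l ∈ quadIdeal W := by
  have hle : quadIdeal W ≤ ((quadIdeal W).matrix X).comap (braidMatrix r) := by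
    refine TwoSidedIdeal.span_le.2 ?_
    rintro _ ⟨S, hS, rfl⟩
    refine (TwoSidedIdeal.mem_comap _).2 <| (TwoSidedIdeal.mem_matrix X _ _).2 fun i l => ?_
    rw [braidMatrix_quad]
    exact quad_mem_quadIdeal (hW.outer_mem S hS i l)
  exact (TwoSidedIdeal.mem_matrix X _ _).1 ((TwoSidedIdeal.mem_comap _).1 (hle hf)) i l

/-- The braiding `c : V ⊗ V ⊗ T(V) → T(V) ⊗ V ⊗ V` as a matrix acting on row vectors:
`c (x_i ⊗ x_j ⊗ f) = ∑ l l', (braidPair r f) (j, i) (l', l) ⊗ x_l ⊗ x_l'`. The two indices of a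
tensor are swapped in order that `braidPair r` be multiplicative. -/
def braidPair (r : X → X → X → X → 𝕜) :
    FreeAlgebra 𝕜 X →ₐ[𝕜] Matrix (X × X) (X × X) (FreeAlgebra 𝕜 X) :=
  ((Matrix.compAlgEquiv X X (FreeAlgebra 𝕜 X) 𝕜).toAlgHom.comp (braidMatrix r).mapMatrix).comp
    (braidMatrix r)

theorem braidPair_apply (r : X → X → X → X → 𝕜) (f : FreeAlgebra 𝕜 X) (x y : X × X) :
    braidPair r f x y = braidMatrix r (braidMatrix r f x.1 y.1) x.2 y.2 := rfl

theorem pairVec_vecMul_braidPair_ι (r : X → X → X → X → 𝕜) (S : Matrix X X 𝕜) (n : X) :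
    Matrix.vecMul (pairVec S) (braidPair r (FreeAlgebra.ι 𝕜 n)) = ∑ m, FreeAlgebra.ι 𝕜 m •
      pairVec (∑ m', (innerSlice r m' m).transpose * S * innerSlice r n m') := by
  ext ⟨l', l⟩
  simp only [Matrix.vecMul, dotProduct, pairVec, braidPair_apply, braidMatrix_ι, map_sum, map_smul,
    Matrix.sum_apply, Matrix.smul_apply, Matrix.mul_apply, Matrix.transpose_apply, innerSlice,
    Matrix.of_apply, Finset.sum_apply, Pi.smul_apply, Finset.mul_sum, Finset.sum_mul, smul_eq_mul,
    Finset.smul_sum, map_mul, ← Finset.sum_product', Finset.univ_product_univ]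
  refine Finset.sum_bij' (fun x _ => (x.2.2, x.2.1, x.1.1, x.1.2))
    (fun x _ => ((x.2.2.1, x.2.2.2), x.2.1, x.1)) (by simp) (by simp) (by simp) (by simp) ?_
  intro x _
  rw [← Algebra.smul_def, ← map_mul, ← map_mul, ← Algebra.commutes, ← Algebra.smul_def,
    smul_smul, smul_smul]
  congr 1
  ring

theorem IsBraidedPrimitive.vecMul_braidPair_mem (hW : IsBraidedPrimitive r W)
    (a : FreeAlgebra 𝕜 X) : ∀ v ∈ extendScalars W,
      Matrix.vecMul v (braidPair r a) ∈ extendScalars W := by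
  induction a using FreeAlgebra.induction with
  | grade0 c =>
    intro v hv
    rw [AlgHom.commutes, Algebra.algebraMap_eq_smul_one, Matrix.vecMul_smul, Matrix.vecMul_one]
    exact Submodule.smul_of_tower_mem _ c hv
  | grade1 n =>
    suffices extendScalars W ≤ (extendScalars W).comap
        (braidPair r (FreeAlgebra.ι 𝕜 n)).vecMulLinear from this
    refine Submodule.span_le.2 ?_
    rintro _ ⟨S, hS, rfl⟩
    rw [SetLike.mem_coe, Submodule.mem_comap, Matrix.vecMulLinear_apply,
      pairVec_vecMul_braidPair_ι]
    exact Submodule.sum_mem _ fun m _ =>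
      Submodule.smul_mem _ _ (pairVec_mem_extendScalars (hW.inner_mem S hS n m))
  | mul a b ha hb => intro v hv; rw [map_mul, ← Matrix.vecMul_vecMul]; exact hb _ (ha _ hv)
  | add a b ha hb =>
    intro v hv
    rw [map_add, Matrix.vecMul_add]
    exact Submodule.add_mem _ (ha _ hv) (hb _ hv)

variable (𝕜) in
/-- Left multiplication by `x_i ⊗ 1` in the braided tensor product `T(V) ⊗ T(V)`. -/
def mulInclLeft (i : X) : Module.End 𝕜 (FreeAlgebra 𝕜 X ⊗[𝕜] FreeAlgebra 𝕜 X) :=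
  TensorProduct.map (LinearMap.mulLeft 𝕜 (FreeAlgebra.ι 𝕜 i)) LinearMap.id

/-- Left multiplication by `1 ⊗ x_i` in the braided tensor product `T(V) ⊗ T(V)`. -/
def mulInclRight (r : X → X → X → X → 𝕜) (i : X) :
    Module.End 𝕜 (FreeAlgebra 𝕜 X ⊗[𝕜] FreeAlgebra 𝕜 X) :=
  ∑ l, TensorProduct.map (braidEntry r i l) (LinearMap.mulLeft 𝕜 (FreeAlgebra.ι 𝕜 l))

theorem mulInclRight_mul_mulInclLeft (r : X → X → X → X → 𝕜) (i j : X) :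
    mulInclRight r i * mulInclLeft 𝕜 j =
      ∑ m, ∑ n, r i j m n • (mulInclLeft 𝕜 m * mulInclRight r n) := by
  refine TensorProduct.ext' fun a b => ?_
  have entry (l : X) : braidEntry r i l (FreeAlgebra.ι 𝕜 j * a) =
      ∑ m, ∑ n, r i j m n • (FreeAlgebra.ι 𝕜 m * braidEntry r n l a) := by
    have mul_entry : braidEntry r i l (FreeAlgebra.ι 𝕜 j * a) =
        ∑ n, braidMatrix r (FreeAlgebra.ι 𝕜 j) i n * braidMatrix r a n l := by
      rw [← Matrix.mul_apply, ← map_mul]; rfl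
    rw [mul_entry, Finset.sum_comm]
    simp only [braidMatrix_ι, Finset.sum_mul, smul_mul_assoc]
    rfl
  simp only [mulInclLeft, mulInclRight, Module.End.mul_apply, LinearMap.sum_apply,
    LinearMap.smul_apply, map_sum, TensorProduct.map_tmul, LinearMap.mulLeft_apply,
    LinearMap.id_apply, entry, TensorProduct.sum_tmul, ← TensorProduct.smul_tmul', Finset.smul_sum]
  rw [Finset.sum_comm]
  exact Finset.sum_congr rfl fun m _ => Finset.sum_comm

theorem lift_comulStep_quad (hW : IsBraidedPrimitive r W) (hS : S ∈ W) :
    FreeAlgebra.lift 𝕜 (comulStep r) (quad S) =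
      ∑ i, ∑ j, S i j • (mulInclLeft 𝕜 i * mulInclLeft 𝕜 j) +
        ∑ i, ∑ j, S i j • (mulInclRight r i * mulInclRight r j) :=
  (lift_quad _ _).trans (hW.sum_smul_mul_add hS (mulInclRight_mul_mulInclLeft r))

theorem lift_comulStep_quad_tmul (hW : IsBraidedPrimitive r W) (hS : S ∈ W)
    (a b : FreeAlgebra 𝕜 X) :
    FreeAlgebra.lift 𝕜 (comulStep r) (quad S) (a ⊗ₜ[𝕜] b) = (quad S * a) ⊗ₜ[𝕜] b +
      ∑ x, Matrix.vecMul (pairVec S) (braidPair r a) x ⊗ₜ[𝕜]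
        (FreeAlgebra.ι 𝕜 x.2 * FreeAlgebra.ι 𝕜 x.1 * b) := by
  rw [lift_comulStep_quad hW hS, LinearMap.add_apply]
  congr 1
  · simp only [mulInclLeft, quad_apply, LinearMap.sum_apply, LinearMap.smul_apply,
      Module.End.mul_apply, TensorProduct.map_tmul, LinearMap.mulLeft_apply, LinearMap.id_apply,
      Finset.sum_mul, TensorProduct.sum_tmul, smul_mul_assoc, TensorProduct.smul_tmul', mul_assoc]
  · simp only [mulInclRight, LinearMap.sum_apply, LinearMap.smul_apply, Module.End.mul_apply,
      map_sum, TensorProduct.map_tmul, LinearMap.mulLeft_apply, Matrix.vecMul, dotProduct, pairVec,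
      braidPair_apply, ← Algebra.smul_def, TensorProduct.sum_tmul, ← TensorProduct.smul_tmul',
      mul_assoc, Finset.smul_sum, ← Finset.sum_product', Finset.univ_product_univ]
    exact Finset.sum_bij' (fun x _ => (x.2, x.1.swap)) (fun x _ => (x.2.swap, x.1)) (by simp)
      (by simp) (by simp) (by simp) (fun _ _ => rfl)

theorem IsBraidedPrimitive.comul_mem (hW : IsBraidedPrimitive r W) {f : FreeAlgebra 𝕜 X}
    (hf : f ∈ quadIdeal W) : comul r f ∈ tensorIdeal (quadIdeal W) := by
  refine lift_apply_mem_of_mem_span (fun i z hz => ?_) ?_ hf _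
  · suffices tensorIdeal (quadIdeal W) ≤ (tensorIdeal (quadIdeal W)).comap (comulStep r i) from
      this hz
    refine Submodule.span_le.2 ?_
    rintro _ ⟨u, v, huv, rfl⟩
    rw [SetLike.mem_coe, Submodule.mem_comap, comulStep_tmul]
    refine Submodule.add_mem _ (Submodule.subset_span ⟨_, _, ?_, rfl⟩)
      (Submodule.sum_mem _ fun l _ => Submodule.subset_span ⟨_, _, ?_, rfl⟩)
    · exact huv.imp_left (TwoSidedIdeal.mul_mem_left _ _ _)
    · exact huv.imp (fun h => hW.braidMatrix_mem h i l) (TwoSidedIdeal.mul_mem_left _ _ _)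
  · rintro _ ⟨S, hS, rfl⟩ z
    induction z using TensorProduct.induction_on with
    | zero => simp
    | add y z hy hz => rw [map_add]; exact Submodule.add_mem _ hy hz
    | tmul a b =>
      rw [lift_comulStep_quad_tmul hW hS]
      exact Submodule.add_mem _
        (Submodule.subset_span ⟨_, _,
          Or.inl (TwoSidedIdeal.mul_mem_right _ _ _ (quad_mem_quadIdeal hS)), rfl⟩)
        (sum_tmul_quad_mem_tensorIdeal
          (hW.vecMul_braidPair_mem a _ (pairVec_mem_extendScalars hS)) b)

/-- The row vector functional `mul ∘ c` on `V ⊗ V`: its value at the index of `x_i ⊗ x_j` is the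
product of the two factors of `c (x_i ⊗ x_j)`. -/
def braidedProduct (r : X → X → X → X → 𝕜) (x : X × X) : FreeAlgebra 𝕜 X :=
  ∑ l, braidMatrix r (FreeAlgebra.ι 𝕜 x.1) x.2 l * FreeAlgebra.ι 𝕜 l

theorem lift_antipodeStep_quad (r : X → X → X → X → 𝕜) (S : Matrix X X 𝕜)
    (a : FreeAlgebra 𝕜 X) :
    FreeAlgebra.lift 𝕜 (antipodeStep r) (quad S) a =
      Matrix.vecMul (pairVec S) (braidPair r a) ⬝ᵥ braidedProduct r := by
  simp only [lift_quad, LinearMap.sum_apply, LinearMap.smul_apply, Module.End.mul_apply,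
    antipodeStep_apply, map_neg, map_sum, map_mul, Matrix.mul_apply, Finset.sum_neg_distrib,
    neg_neg, Matrix.vecMul, dotProduct, pairVec, braidPair_apply, braidedProduct,
    ← Algebra.smul_def, Finset.sum_mul, Finset.mul_sum, Finset.smul_sum, smul_mul_assoc, mul_assoc,
    ← Finset.sum_product', Finset.univ_product_univ]
  exact Finset.sum_bij' (fun x _ => ((x.2.1, x.2.2.2), x.2.2.1, (x.1.2, x.1.1)))
    (fun x _ => ((x.2.2.2, x.2.2.1), x.1.1, x.2.1, x.1.2)) (by simp) (by simp) (by simp) (by simp)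
    (fun _ _ => rfl)

theorem IsBraidedPrimitive.pairVec_dotProduct_braidedProduct (hW : IsBraidedPrimitive r W)
    (hS : S ∈ W) : pairVec S ⬝ᵥ braidedProduct r = -quad S := by
  have expand : pairVec S ⬝ᵥ braidedProduct r = ∑ m, ∑ n, (∑ i, ∑ j, S i j * r i j m n) •
      (FreeAlgebra.ι 𝕜 m * FreeAlgebra.ι 𝕜 n) := by
    simp only [dotProduct, pairVec, braidedProduct, braidMatrix_ι, ← Algebra.smul_def,
      Finset.sum_mul, Finset.smul_sum, smul_mul_assoc, smul_smul, Finset.sum_smul,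
      ← Finset.sum_product', Finset.univ_product_univ]
    exact Finset.sum_bij' (fun x _ => (x.2.2, x.2.1, x.1.2, x.1.1))
      (fun x _ => ((x.2.2.2, x.2.2.1), x.2.1, x.1)) (by simp) (by simp) (by simp) (by simp)
      (fun _ _ => rfl)
  simp only [expand, hW.braiding_eq_neg S hS, neg_smul, Finset.sum_neg_distrib, quad_apply]

theorem IsBraidedPrimitive.dotProduct_braidedProduct_mem (hW : IsBraidedPrimitive r W)
    {v : X × X → FreeAlgebra 𝕜 X} (hv : v ∈ extendScalars W) :
    v ⬝ᵥ braidedProduct r ∈ quadIdeal W := by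
  induction hv using Submodule.span_induction with
  | mem v hv =>
    obtain ⟨S, hS, rfl⟩ := hv
    rw [hW.pairVec_dotProduct_braidedProduct hS]
    exact TwoSidedIdeal.neg_mem _ (quad_mem_quadIdeal hS)
  | zero => rw [zero_dotProduct]; exact TwoSidedIdeal.zero_mem _
  | add v w _ _ hv hw => rw [add_dotProduct]; exact TwoSidedIdeal.add_mem _ hv hw
  | smul s v _ hv => rw [smul_dotProduct]; exact TwoSidedIdeal.mul_mem_left _ _ _ hv

theorem IsBraidedPrimitive.antipode_mem (hW : IsBraidedPrimitive r W) {f : FreeAlgebra 𝕜 X}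
    (hf : f ∈ quadIdeal W) : antipode r f ∈ quadIdeal W := by
  suffices antipode r f ∈ (quadIdeal W).asIdeal.restrictScalars 𝕜 from this
  refine lift_apply_mem_of_mem_span (fun i v hv => ?_) ?_ hf _
  · rw [antipodeStep_apply]
    exact Submodule.neg_mem _ (Submodule.sum_mem _ fun l _ =>
      TwoSidedIdeal.mul_mem_right _ _ _ (hW.braidMatrix_mem hv i l))
  · rintro _ ⟨S, hS, rfl⟩ a
    rw [lift_antipodeStep_quad]
    exact hW.dotProduct_braidedProduct_mem
      (hW.vecMul_braidPair_mem a _ (pairVec_mem_extendScalars hS))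

theorem IsBraidedPrimitive.isHopfIdeal (hW : IsBraidedPrimitive r W) :
    IsHopfIdeal r (quadIdeal W) where
  generated := by
    refine ⟨_, ?_, rfl⟩
    rintro _ ⟨S, -, rfl⟩
    exact ⟨2, le_rfl, quad_mem_degreePart S⟩
  comul_mem _ hf := hW.comul_mem hf
  antipode_mem _ hf := hW.antipode_mem hf

end HopfIdeal

/-! ### Skew derivations -/

section LinearPart

variable (𝕜 : Type*) [Field 𝕜] (X : Type*) [DecidableEq X]

/-- The truncation of an element of `T(V)` to degrees at most one. -/
def linearPart : FreeAlgebra 𝕜 X →ₐ[𝕜] TrivSqZeroExt 𝕜 (X → 𝕜) :=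
  FreeAlgebra.lift 𝕜 fun i => TrivSqZeroExt.inr (Pi.single i 1)

theorem linearPart_ι (i : X) :
    linearPart 𝕜 X (FreeAlgebra.ι 𝕜 i) = TrivSqZeroExt.inr (Pi.single i 1) :=
  FreeAlgebra.lift_ι_apply _ _

/-- The counit of `T(V)`. -/
def counit : FreeAlgebra 𝕜 X →ₐ[𝕜] 𝕜 :=
  (TrivSqZeroExt.fstHom 𝕜 𝕜 (X → 𝕜)).comp (linearPart 𝕜 X)

variable {X} in
/-- The coefficient of `x_l` in an element of `T(V)`. -/
def linearCoeff (l : X) : FreeAlgebra 𝕜 X →ₗ[𝕜] 𝕜 :=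
  LinearMap.proj l ∘ₗ TrivSqZeroExt.sndHom 𝕜 (X → 𝕜) ∘ₗ (linearPart 𝕜 X).toLinearMap

variable {𝕜 X}

theorem counit_ι_mul (i : X) (f : FreeAlgebra 𝕜 X) :
    counit 𝕜 X (FreeAlgebra.ι 𝕜 i * f) = 0 := by
  simp [counit, linearPart_ι]

theorem linearCoeff_ι_mul (l i : X) (f : FreeAlgebra 𝕜 X) :
    linearCoeff 𝕜 l (FreeAlgebra.ι 𝕜 i * f) = if l = i then counit 𝕜 X f else 0 := by
  simp [linearCoeff, counit, linearPart_ι, Pi.single_apply]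

theorem linearPart_eq_zero {n : ℕ} (hn : 2 ≤ n) {f : FreeAlgebra 𝕜 X}
    (hf : f ∈ degreePart 𝕜 X n) : linearPart 𝕜 X f = 0 := by
  have span_le : Submodule.span 𝕜 (Set.range (FreeAlgebra.ι 𝕜 (X := X))) ≤
      LinearMap.ker (counit 𝕜 X).toLinearMap := by
    refine Submodule.span_le.2 ?_
    rintro _ ⟨i, rfl⟩
    simp [counit, linearPart_ι]
  obtain ⟨m, rfl⟩ := Nat.exists_eq_add_of_le hn
  rw [degreePart, pow_add, pow_two] at hf
  induction hf using Submodule.mul_induction_on' with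
  | mem_mul_mem u hu v _ =>
    suffices linearPart 𝕜 X u = 0 by rw [map_mul, this, zero_mul]
    induction hu using Submodule.mul_induction_on' with
    | mem_mul_mem a ha b hb =>
      have ha : (linearPart 𝕜 X a).fst = 0 := span_le ha
      have hb : (linearPart 𝕜 X b).fst = 0 := span_le hb
      ext <;> simp [ha, hb]
    | add a _ b _ ha hb => rw [map_add, ha, hb, add_zero]
  | add u _ v _ hu hv => rw [map_add, hu, hv, add_zero]

end LinearPart

section Braided

variable {𝕜 : Type*} [Field 𝕜] {X : Type*}

theorem mkₐ_eq_zero_iff (I : TwoSidedIdeal (FreeAlgebra 𝕜 X)) {f : FreeAlgebra 𝕜 X} :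
    I.ringCon.mkₐ 𝕜 f = 0 ↔ f ∈ I := by
  rw [TwoSidedIdeal.mem_iff, ← RingCon.eq]
  rfl

/-- The contraction `id ⊗ φ` of the second tensor factor by a functional. -/
def contractRight (φ : FreeAlgebra 𝕜 X →ₗ[𝕜] 𝕜) :
    FreeAlgebra 𝕜 X ⊗[𝕜] FreeAlgebra 𝕜 X →ₗ[𝕜] FreeAlgebra 𝕜 X :=
  (TensorProduct.rid 𝕜 (FreeAlgebra 𝕜 X)).toLinearMap ∘ₗ φ.lTensor (FreeAlgebra 𝕜 X)

theorem contractRight_tmul (φ : FreeAlgebra 𝕜 X →ₗ[𝕜] 𝕜) (u v : FreeAlgebra 𝕜 X) :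
    contractRight φ (u ⊗ₜ[𝕜] v) = φ v • u := rfl

variable [Fintype X] [DecidableEq X]

theorem linearPart_of_mem_nicholsIdeal {r : X → X → X → X → 𝕜} {f : FreeAlgebra 𝕜 X}
    (hf : f ∈ nicholsIdeal r) : linearPart 𝕜 X f = 0 := by
  obtain ⟨S, hS, hspan⟩ := (nicholsIdeal_isGreatest r).1.generated
  have hle : nicholsIdeal r ≤ TwoSidedIdeal.ker (linearPart 𝕜 X) := by
    rw [hspan]
    refine TwoSidedIdeal.span_le.2 fun s hs => ?_
    obtain ⟨n, hn, hsn⟩ := hS s hs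
    exact (TwoSidedIdeal.mem_ker _).2 (linearPart_eq_zero hn hsn)
  exact (TwoSidedIdeal.mem_ker _).1 (hle hf)

section SkewDerivation

variable (r : X → X → X → X → 𝕜)

theorem comul_one : comul r 1 = 1 ⊗ₜ[𝕜] 1 := by
  simp [comul]

theorem comul_ι_mul (i : X) (f : FreeAlgebra 𝕜 X) :
    comul r (FreeAlgebra.ι 𝕜 i * f) = comulStep r i (comul r f) := by
  simp [comul]

theorem contractRight_counit_comulStep (i : X) (z : FreeAlgebra 𝕜 X ⊗[𝕜] FreeAlgebra 𝕜 X) :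
    contractRight (counit 𝕜 X).toLinearMap (comulStep r i z) =
      FreeAlgebra.ι 𝕜 i * contractRight (counit 𝕜 X).toLinearMap z := by
  induction z using TensorProduct.induction_on with
  | zero => simp
  | add y z hy hz => simp only [map_add, hy, hz, mul_add]
  | tmul u v => simp [comulStep_tmul, contractRight_tmul, counit_ι_mul]

theorem contractRight_counit_comul (f : FreeAlgebra 𝕜 X) :
    contractRight (counit 𝕜 X).toLinearMap (comul r f) = f := by
  have lift_comulStep (f : FreeAlgebra 𝕜 X) : ∀ z,
      contractRight (counit 𝕜 X).toLinearMap (FreeAlgebra.lift 𝕜 (comulStep r) f z) =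
        f * contractRight (counit 𝕜 X).toLinearMap z := by
    induction f using FreeAlgebra.induction with
    | grade0 c => simp [Algebra.smul_def]
    | grade1 i => simp [contractRight_counit_comulStep]
    | mul a b ha hb => simp [ha, hb, mul_assoc]
    | add a b ha hb => simp [ha, hb, add_mul]
  refine (lift_comulStep f (1 ⊗ₜ 1)).trans ?_
  rw [contractRight_tmul, AlgHom.toLinearMap_apply, map_one, one_smul, mul_one]

/-- The skew derivation `∂_l` of `T(V)`: the component of `Δ f` in `T(V) ⊗ x_l`. -/
def skewDer (l : X) : FreeAlgebra 𝕜 X →ₗ[𝕜] FreeAlgebra 𝕜 X :=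
  contractRight (linearCoeff 𝕜 l) ∘ₗ comul r

theorem skewDer_ι_mul (l i : X) (f : FreeAlgebra 𝕜 X) :
    skewDer r l (FreeAlgebra.ι 𝕜 i * f) =
      FreeAlgebra.ι 𝕜 i * skewDer r l f + braidMatrix r f i l := by
  have contract_comulStep (z : FreeAlgebra 𝕜 X ⊗[𝕜] FreeAlgebra 𝕜 X) :
      contractRight (linearCoeff 𝕜 l) (comulStep r i z) =
        FreeAlgebra.ι 𝕜 i * contractRight (linearCoeff 𝕜 l) z +
          braidMatrix r (contractRight (counit 𝕜 X).toLinearMap z) i l := by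
    induction z using TensorProduct.induction_on with
    | zero => simp
    | add y z hy hz => simp only [map_add, hy, hz, mul_add, Matrix.add_apply]; abel
    | tmul u v => simp [comulStep_tmul, contractRight_tmul, linearCoeff_ι_mul]
  rw [skewDer, LinearMap.comp_apply, comul_ι_mul, contract_comulStep, contractRight_counit_comul]
  rfl

theorem skewDer_one (l : X) : skewDer r l 1 = 0 := by
  simp [skewDer, comul_one, contractRight_tmul, linearCoeff]

theorem skewDer_ι (l i : X) : skewDer r l (FreeAlgebra.ι 𝕜 i) = if i = l then 1 else 0 := by
  have h := skewDer_ι_mul r l i 1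
  rwa [mul_one, skewDer_one, mul_zero, zero_add, map_one, Matrix.one_apply] at h

theorem skewDer_mul (l : X) (f g : FreeAlgebra 𝕜 X) :
    skewDer r l (f * g) = f * skewDer r l g + ∑ j, skewDer r j f * braidMatrix r g j l := by
  induction f using FreeAlgebra.induction generalizing l g with
  | grade0 c => simp [Algebra.algebraMap_eq_smul_one, skewDer_one]
  | grade1 i => simp [skewDer_ι_mul, skewDer_ι]
  | mul a b ha hb =>
    rw [mul_assoc, ha, hb, map_mul]
    simp only [fun j => ha j b, Matrix.mul_apply, mul_add, add_mul, Finset.sum_add_distrib,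
      Finset.mul_sum, Finset.sum_mul, mul_assoc, add_assoc]
    congr 2
    rw [Finset.sum_comm]
  | add a b ha hb => simp only [add_mul, map_add, ha, hb, Finset.sum_add_distrib]; abel

variable {r}

theorem skewDer_mem_nicholsIdeal (l : X) {f : FreeAlgebra 𝕜 X} (hf : f ∈ nicholsIdeal r) :
    skewDer r l f ∈ nicholsIdeal r := by
  let K := (nicholsIdeal r).asIdeal.restrictScalars 𝕜
  suffices tensorIdeal (nicholsIdeal r) ≤ K.comap (contractRight (linearCoeff 𝕜 l)) from
    this ((nicholsIdeal_isGreatest r).1.comul_mem f hf)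
  refine Submodule.span_le.2 ?_
  rintro _ ⟨u, v, hu | hv, rfl⟩
  · exact K.smul_mem _ hu
  · have : linearCoeff 𝕜 l v = 0 := by simp [linearCoeff, linearPart_of_mem_nicholsIdeal hv]
    rw [SetLike.mem_coe, Submodule.mem_comap, contractRight_tmul, this, zero_smul]
    exact K.zero_mem

end SkewDerivation

section NicholsAlgebra

variable (r : X → X → X → X → 𝕜)

/-- The projection `T(V) → 𝔅(V)`. -/
def proj : FreeAlgebra 𝕜 X →ₐ[𝕜] NicholsAlgebra r := (nicholsIdeal r).ringCon.mkₐ 𝕜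

theorem proj_surjective : Function.Surjective (proj r) := RingCon.mkₐ_surjective _

theorem proj_ι (i : X) : proj r (FreeAlgebra.ι 𝕜 i) = gen r i := rfl

theorem proj_eq_zero_iff {f : FreeAlgebra 𝕜 X} : proj r f = 0 ↔ f ∈ nicholsIdeal r :=
  mkₐ_eq_zero_iff _

instance : Nontrivial (NicholsAlgebra r) := by
  refine ⟨⟨1, 0, fun h => ?_⟩⟩
  rw [← map_one (proj r), proj_eq_zero_iff] at h
  simpa using congrArg TrivSqZeroExt.fst (linearPart_of_mem_nicholsIdeal h)

/-- The skew derivation of `𝔅(V)` induced by `∂_l`. -/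
def nicholsDer (l : X) : NicholsAlgebra r →ₗ[𝕜] NicholsAlgebra r :=
  (LinearMap.ker (proj r).toLinearMap).liftQ ((proj r).toLinearMap ∘ₗ skewDer r l)
      (fun _ hf => (proj_eq_zero_iff r).2 <|
        skewDer_mem_nicholsIdeal l <| (proj_eq_zero_iff r).1 hf) ∘ₗ
    ((proj r).toLinearMap.quotKerEquivOfSurjective (proj_surjective r)).symm.toLinearMap

theorem nicholsDer_proj (l : X) (f : FreeAlgebra 𝕜 X) :
    nicholsDer r l (proj r f) = proj r (skewDer r l f) := by
  have symm_proj : ((proj r).toLinearMap.quotKerEquivOfSurjective (proj_surjective r)).symm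
      (proj r f) = Submodule.Quotient.mk f :=
    (LinearEquiv.symm_apply_eq _).2 rfl
  rw [nicholsDer, LinearMap.comp_apply, LinearEquiv.coe_coe, symm_proj]
  rfl

theorem nicholsDer_one (l : X) : nicholsDer r l 1 = 0 := by
  rw [← map_one (proj r), nicholsDer_proj, skewDer_one, map_zero]

theorem nicholsDer_mul_gen (l j : X) (u : NicholsAlgebra r) :
    nicholsDer r l (u * gen r j) = (if j = l then u else 0) +
      ∑ i, nicholsDer r i u * ∑ m, r i j m l • gen r m := by
  obtain ⟨f, rfl⟩ := proj_surjective r u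
  rw [← proj_ι, ← map_mul, nicholsDer_proj, skewDer_mul, skewDer_ι]
  simp only [map_add, map_sum, map_mul, nicholsDer_proj, braidMatrix_ι, map_smul, proj_ι]
  split_ifs <;> simp

theorem nicholsDer_gen (l j : X) : nicholsDer r l (gen r j) = if j = l then 1 else 0 := by
  have h := nicholsDer_mul_gen r l j 1
  simpa only [one_mul, nicholsDer_one, zero_mul, Finset.sum_const_zero, add_zero] using h

end NicholsAlgebra

end Braided

/-! ### Independence of ordered monomials -/

section Lowering

variable {𝕜 M ι : Type*} [Field 𝕜] [AddCommGroup M] [Module 𝕜 M] {D : Module.End 𝕜 M}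
  {v : ι → M} {t : Set ι} {w : ℕ × ι → M}

theorem linearIndepOn_prod_of_lowering (hv : LinearIndepOn 𝕜 v t) {s : Set ℕ} {c : ℕ → 𝕜}
    (hc : ∀ n ∈ s, c n ≠ 0) (hpow : ∀ n ∈ s, ∀ i ∈ t, (D ^ n) (w (n, i)) = c n • v i)
    (hkill : ∀ n ∈ s, ∀ i ∈ t, (D ^ (n + 1)) (w (n, i)) = 0) :
    LinearIndepOn 𝕜 w (s ×ˢ t) := by
  classical
  refine linearIndepOn_iff'.2 fun S g hS hsum => ?_
  by_contra! hne
  let supp := S.filter fun x => g x ≠ 0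
  have hsupp : supp.Nonempty := by simpa [supp, Finset.Nonempty] using hne
  obtain ⟨⟨n, i⟩, hni, hmax⟩ := supp.exists_max_image Prod.fst hsupp
  obtain ⟨hniS, hgni⟩ := Finset.mem_filter.1 hni
  let layer := (S.filter fun x => x.1 = n).image Prod.snd
  have lower {x : ℕ × ι} (hx : x ∈ S) (hxn : x.1 ≠ n) : (D ^ n) (g x • w x) = 0 := by
    by_cases hgx : g x = 0
    · rw [hgx, zero_smul, map_zero]
    · have hlt : x.1 < n := (hmax x (Finset.mem_filter.2 ⟨hx, hgx⟩)).lt_of_ne hxn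
      obtain ⟨m, rfl⟩ := Nat.exists_eq_add_of_lt hlt
      rw [map_smul, show x.1 + m + 1 = m + (x.1 + 1) by ring, pow_add, Module.End.mul_apply,
        hkill _ (hS hx).1 _ (hS hx).2, map_zero, smul_zero]
  have hlayer : ∑ j ∈ layer, (g (n, j) * c n) • v j = 0 := by
    rw [Finset.sum_image (by rintro ⟨a, j⟩ hj ⟨a', j'⟩ hj'; simp_all)]
    calc ∑ x ∈ S with x.1 = n, (g (n, x.2) * c n) • v x.2
        = ∑ x ∈ S with x.1 = n, (D ^ n) (g x • w x) := by
          refine Finset.sum_congr rfl fun ⟨m, j⟩ hx => ?_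
          obtain ⟨hxS, rfl⟩ := Finset.mem_filter.1 hx
          rw [map_smul, hpow _ (hS hxS).1 _ (hS hxS).2, smul_smul]
      _ = ∑ x ∈ S, (D ^ n) (g x • w x) :=
          Finset.sum_filter_of_ne fun x hx hne => by_contra fun hxn => hne (lower hx hxn)
      _ = 0 := by rw [← map_sum, hsum, map_zero]
  have hlayer_sub : (layer : Set ι) ⊆ t := by
    intro j hj
    obtain ⟨x, hx, rfl⟩ := Finset.mem_image.1 hj
    exact (hS (Finset.mem_filter.1 hx).1).2
  have hi : i ∈ layer := Finset.mem_image.2 ⟨(n, i), Finset.mem_filter.2 ⟨hniS, rfl⟩, rfl⟩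
  exact mul_ne_zero hgni (hc n (hS hniS).1)
    (linearIndepOn_iff'.1 hv layer (fun j => g (n, j) * c n) hlayer_sub hlayer i hi)

theorem linearIndepOn_prod_of_lowering_two (hv : LinearIndepOn 𝕜 v t)
    (hzero : ∀ i ∈ t, w (0, i) = v i) (hone : ∀ i ∈ t, D (w (1, i)) = v i)
    (hD : ∀ i ∈ t, D (v i) = 0) : LinearIndepOn 𝕜 w ({n | n < 2} ×ˢ t) := by
  refine linearIndepOn_prod_of_lowering (D := D) hv (c := 1) (fun _ _ => one_ne_zero) ?_ ?_ <;>
  · intro n hn i hi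
    obtain rfl | rfl : n = 0 ∨ n = 1 := by have : n < 2 := hn; lia
    all_goals simp [hzero i hi, hone i hi, hD i hi, pow_two]

end Lowering

section Algebra

variable {𝕜 A : Type*} [Field 𝕜] [Ring A] [Algebra 𝕜 A]

/-- The ordered monomial `y₁^{e₁} y₂^{e₂} y₃^{e₃}`. -/
def orderedMonomial (y : Fin 3 → A) (e : Fin 3 → ℕ) : A := y 0 ^ e 0 * y 1 ^ e 1 * y 2 ^ e 2

theorem map_mul_of_mem_adjoin {D : Module.End 𝕜 A} {s : Set A}
    (h : ∀ u ∈ s, ∀ f, D (u * f) = u * D f) {g : A} (hg : g ∈ Algebra.adjoin 𝕜 s) (f : A) :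
    D (g * f) = g * D f := by
  induction hg using Algebra.adjoin_induction generalizing f with
  | mem u hu => exact h u hu f
  | algebraMap c => rw [← Algebra.smul_def, map_smul, ← Algebra.smul_def]
  | add u v _ _ hu hv => rw [add_mul, map_add, hu, hv, add_mul]
  | mul u v _ _ hu hv => rw [mul_assoc, hu, hv, mul_assoc]

theorem pow_apply_mul {D : Module.End 𝕜 A} {g : A} (h : ∀ f, D (g * f) = g * D f) (n : ℕ) (f : A) :
    (D ^ n) (g * f) = g * (D ^ n) f := by
  induction n generalizing f with
  | zero => rfl
  | succ n ih => rw [pow_succ, Module.End.mul_apply, Module.End.mul_apply, h, ih]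

theorem linearIndepOn_mul_pow_of_lowering {ι : Type*} {v : ι → A} {t : Set ι}
    (hv : LinearIndepOn 𝕜 v t) {D : Module.End 𝕜 A} {y : A} (hDv : ∀ i f, D (v i * f) = v i * D f)
    (hone : D 1 = 0) {s : Set ℕ} {c : ℕ → 𝕜} (hc : ∀ n ∈ s, c n ≠ 0)
    (hpow : ∀ n ∈ s, (D ^ n) (y ^ n) = c n • 1) :
    LinearIndepOn 𝕜 (fun x : ℕ × ι => v x.2 * y ^ x.1) (s ×ˢ t) :=
  linearIndepOn_prod_of_lowering hv hc
    (fun n hn i _ => by rw [pow_apply_mul (hDv i), hpow n hn, mul_smul_comm, mul_one])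
    (fun n hn i _ => by
      rw [pow_succ', Module.End.mul_apply, pow_apply_mul (hDv i), hpow n hn, hDv, map_smul, hone,
        smul_zero, mul_zero])

theorem linearIndepOn_orderedMonomial [Nontrivial A] {y : Fin 3 → A} {D : Fin 3 → Module.End 𝕜 A}
    {s : Set ℕ} {c : ℕ → 𝕜} (hc : ∀ n ∈ s, c n ≠ 0)
    (hD : ∀ i j, i < j → ∀ f, D j (y i * f) = y i * D j f) (hone : ∀ j, D j 1 = 0)
    (hpow : ∀ j, ∀ n ∈ s, (D j ^ n) (y j ^ n) = c n • 1) :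
    LinearIndepOn 𝕜 (orderedMonomial y) {e | ∀ i, e i ∈ s} := by
  have hDpow {i j : Fin 3} (hij : i < j) (n : ℕ) : ∀ f, D j (y i ^ n * f) = y i ^ n * D j f :=
    map_mul_of_mem_adjoin (s := {y i}) (by rintro _ rfl; exact hD i j hij)
      (pow_mem (Algebra.self_mem_adjoin_singleton 𝕜 (y i)) n)
  have L0 : LinearIndepOn 𝕜 (fun x : ℕ × Unit => 1 * y 0 ^ x.1) (s ×ˢ Set.univ) :=
    linearIndepOn_mul_pow_of_lowering (v := fun _ : Unit => (1 : A)) (by simp)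
      (fun _ f => by rw [one_mul, one_mul]) (hone 0) hc (hpow 0)
  have L1 := linearIndepOn_mul_pow_of_lowering L0 (D := D 1)
    (fun x f => by simp only [one_mul, hDpow (show (0 : Fin 3) < 1 by decide)])
    (hone 1) hc (hpow 1)
  have L2 := linearIndepOn_mul_pow_of_lowering L1 (D := D 2)
    (fun x f => by simp only [one_mul, mul_assoc, hDpow (show (0 : Fin 3) < 2 by decide),
      hDpow (show (1 : Fin 3) < 2 by decide)]) (hone 2) hc (hpow 2)
  let φ : (Fin 3 → ℕ) → ℕ × ℕ × ℕ × Unit := fun e => (e 2, e 1, e 0, ())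
  have hφ : Function.Injective φ := fun e e' h => by
    ext i
    fin_cases i
    exacts [congrArg (·.2.2.1) h, congrArg (·.2.1) h, congrArg (·.1) h]
  have himage : φ '' {e | ∀ i, e i ∈ s} ⊆ s ×ˢ s ×ˢ s ×ˢ Set.univ := by
    rintro _ ⟨e, he, rfl⟩
    exact ⟨he 2, he 1, he 0, trivial⟩
  refine ((L2.mono himage).comp_of_image hφ.injOn).congr fun e _ => ?_
  simp only [Function.comp_apply, φ, one_mul, orderedMonomial]

/-- If `D` is a skew derivation with `D y = 1` and twist `y ↦ y + w`, `w` being a `D`-constant,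
then on `D`-nilpotent elements multiplication by `y` shifts the leading iterate as in the
polynomial ring. -/
theorem pow_succ_apply_mul {D : Module.End 𝕜 A} {K : Submodule 𝕜 A} {y w : A}
    (hK : ∀ f ∈ K, D f ∈ K) (hy : ∀ f ∈ K, D (f * y) = f + D f * (y + w))
    (hw : ∀ f ∈ K, D (f * w) = D f * w) (n : ℕ) {f : A} (hf : f ∈ K)
    (hkill : (D ^ (n + 1)) f = 0) : (D ^ (n + 1)) (f * y) = (n + 1 : 𝕜) • (D ^ n) f := by
  induction n generalizing f with
  | zero =>
    rw [zero_add, pow_one] at hkill ⊢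
    simp [hy f hf, hkill]
  | succ n ih =>
    have pow_mul_w (m : ℕ) : ∀ f ∈ K, (D ^ m) (f * w) = (D ^ m) f * w := by
      induction m with
      | zero => exact fun f _ => rfl
      | succ m ih =>
        intro f hf
        rw [pow_succ, Module.End.mul_apply, hw f hf, ih _ (hK f hf), Module.End.mul_apply]
    have shift (m : ℕ) (u : A) : (D ^ m) (D u) = (D ^ (m + 1)) u := by
      rw [pow_succ, Module.End.mul_apply]
    have hy' : (D ^ (n + 1)) (D f * y) = (n + 1 : 𝕜) • (D ^ n) (D f) :=
      ih (hK f hf) (by rw [shift, hkill])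
    rw [← shift, hy f hf, mul_add, map_add, map_add, pow_mul_w _ _ (hK f hf), hy', shift, shift,
      hkill, zero_mul, add_zero]
    push_cast
    module

theorem pow_apply_pow {D : Module.End 𝕜 A} {K : Subalgebra 𝕜 A} {y w : A} (hone : D 1 = 0)
    (hyK : y ∈ K) (hK : ∀ f ∈ K, D f ∈ K) (hy : ∀ f ∈ K, D (f * y) = f + D f * (y + w))
    (hw : ∀ f ∈ K, D (f * w) = D f * w) (n : ℕ) : (D ^ n) (y ^ n) = (n.factorial : 𝕜) • 1 := by
  induction n with
  | zero => simp
  | succ n ih =>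
    have hkill : (D ^ (n + 1)) (y ^ n) = 0 := by
      rw [pow_succ', Module.End.mul_apply, ih, map_smul, hone, smul_zero]
    rw [pow_succ y, pow_succ_apply_mul (K := K.toSubmodule) hK hy hw n (pow_mem hyK n) hkill, ih,
      smul_smul, Nat.factorial_succ]
    push_cast
    rfl

end Algebra

section Triangular

variable {𝕜 : Type*} [Field 𝕜] {X : Type*} [Fintype X] [DecidableEq X]
  {r : X → X → X → X → 𝕜}

theorem nicholsDer_mem_adjoin {s : Set X} (hs : ∀ i, ∀ j ∈ s, ∀ m ∉ s, ∀ l, r i j m l = 0) (l : X)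
    {f : NicholsAlgebra r} (hf : f ∈ Algebra.adjoin 𝕜 (gen r '' s)) :
    nicholsDer r l f ∈ Algebra.adjoin 𝕜 (gen r '' s) := by
  have hle : (Algebra.adjoin 𝕜 (gen r '' s)).toSubmodule ≤
      (Algebra.adjoin 𝕜 (gen r '' s)).toSubmodule ⊓
        ⨅ l, (Algebra.adjoin 𝕜 (gen r '' s)).toSubmodule.comap (nicholsDer r l) := by
    rw [Algebra.adjoin_eq_span, Submodule.span_le, ← Algebra.adjoin_eq_span]
    intro u hu
    simp only [SetLike.mem_coe, Submodule.mem_inf, Submodule.mem_iInf, Submodule.mem_comap,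
      Subalgebra.mem_toSubmodule]
    induction hu using Submonoid.closure_induction_right with
    | one => simp [nicholsDer_one]
    | mul_right u _ g hg ih =>
      obtain ⟨j, hj, rfl⟩ := hg
      refine ⟨mul_mem ih.1 (Algebra.subset_adjoin (Set.mem_image_of_mem _ hj)), fun l => ?_⟩
      rw [nicholsDer_mul_gen]
      refine add_mem (by split_ifs; exacts [ih.1, zero_mem _]) <| sum_mem fun i _ =>
        mul_mem (ih.2 i) <| sum_mem fun m _ => ?_
      by_cases hm : m ∈ s
      · exact Subalgebra.smul_mem _ (Algebra.subset_adjoin (Set.mem_image_of_mem _ hm)) _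
      · rw [hs i j hj m hm l, zero_smul]
        exact zero_mem _
  exact (Submodule.mem_iInf _).1 (hle hf).2 l

variable [LinearOrder X]

theorem braidMatrix_eq_zero (hr : ∀ i j m l, i < l → r i j m l = 0) (f : FreeAlgebra 𝕜 X) :
    ∀ i l, i < l → braidMatrix r f i l = 0 := by
  induction f using FreeAlgebra.induction with
  | grade0 c =>
    intro i l hil
    rw [AlgHom.commutes, Matrix.algebraMap_matrix_apply, if_neg hil.ne]
  | grade1 n => intro i l hil; simp [braidMatrix_ι, hr _ _ _ _ hil]
  | mul f g hf hg =>
    intro i l hil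
    rw [map_mul, Matrix.mul_apply]
    refine Finset.sum_eq_zero fun j _ => ?_
    rcases lt_or_ge i j with h | h
    · rw [hf i j h, zero_mul]
    · rw [hg j l (h.trans_lt hil), mul_zero]
  | add f g hf hg =>
    intro i l hil
    rw [map_add, Matrix.add_apply, hf i l hil, hg i l hil, add_zero]

theorem nicholsDer_gen_mul (hr : ∀ i j m l, i < l → r i j m l = 0) {i l : X} (hil : i < l)
    (f : NicholsAlgebra r) : nicholsDer r l (gen r i * f) = gen r i * nicholsDer r l f := by
  obtain ⟨f, rfl⟩ := proj_surjective r f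
  rw [← proj_ι, ← map_mul, nicholsDer_proj, nicholsDer_proj, skewDer_ι_mul,
    braidMatrix_eq_zero hr f i l hil, add_zero, map_mul]

theorem nicholsDer_eq_zero_of_mem_adjoin (hr : ∀ i j m l, i < l → r i j m l = 0) {l : X}
    {f : NicholsAlgebra r} (hf : f ∈ Algebra.adjoin 𝕜 (gen r '' Set.Iio l)) :
    nicholsDer r l f = 0 := by
  have hlin : ∀ u ∈ gen r '' Set.Iio l, ∀ f, nicholsDer r l (u * f) = u * nicholsDer r l f := by
    rintro _ ⟨i, hi, rfl⟩
    exact nicholsDer_gen_mul hr hi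
  have h := map_mul_of_mem_adjoin hlin hf 1
  rwa [mul_one, nicholsDer_one, mul_zero] at h

theorem nicholsDer_mul_gen_of_mem_adjoin (hr : ∀ i j m l, i < l → r i j m l = 0) {l : X}
    {f : NicholsAlgebra r} (hf : f ∈ Algebra.adjoin 𝕜 (gen r '' Set.Iic l)) (j : X) :
    nicholsDer r l (f * gen r j) =
      (if j = l then f else 0) + nicholsDer r l f * ∑ m, r l j m l • gen r m := by
  rw [nicholsDer_mul_gen, Finset.sum_eq_single_of_mem l (Finset.mem_univ l)]
  intro i _ hil
  rcases hil.lt_or_gt with hil | hli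
  · simp only [hr i j _ l hil, zero_smul, Finset.sum_const_zero, mul_zero]
  · have hsub : gen r '' Set.Iic l ⊆ gen r '' Set.Iio i :=
      Set.image_mono fun x hx => lt_of_le_of_lt hx hli
    rw [nicholsDer_eq_zero_of_mem_adjoin hr (Algebra.adjoin_mono hsub hf), zero_mul]

end Triangular

/-! ### Gelfand–Kirillov dimension -/

section Growth

theorem tendsto_log_mul_pow_div_log {C : ℝ} (hC : 0 < C) (D : ℕ) :
    Filter.Tendsto (fun n : ℕ => ((Real.log (C * (n : ℝ) ^ D) / Real.log n : ℝ) : EReal))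
      Filter.atTop (nhds (D : EReal)) := by
  have hlog : Filter.Tendsto (fun n : ℕ => Real.log (n : ℝ)) Filter.atTop Filter.atTop :=
    Real.tendsto_log_atTop.comp tendsto_natCast_atTop_atTop
  have hlim : Filter.Tendsto (fun n : ℕ => Real.log C / Real.log (n : ℝ) + D) Filter.atTop
      (nhds D) := by
    simpa only [zero_add] using (hlog.const_div_atTop (Real.log C)).add_const (D : ℝ)
  refine (continuous_coe_real_ereal.tendsto (D : ℝ)).comp (hlim.congr' ?_)
  filter_upwards [Filter.eventually_gt_atTop 1] with n hn
  have hn' : (1 : ℝ) < n := Nat.one_lt_cast.2 hn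
  have hpos : 0 < Real.log (n : ℝ) := Real.log_pos hn'
  rw [Real.log_mul hC.ne' (by positivity), Real.log_pow]
  field_simp

variable {𝕜 A : Type*} [Field 𝕜] [Ring A] [Algebra 𝕜 A] {D : ℕ}

theorem gkDim_le_of_finrank_le
    (hup : ∀ W : Submodule 𝕜 A, W.FG → ∃ C : ℕ, 0 < C ∧ ∀ n, 0 < n →
      Module.finrank 𝕜 (⨆ i ≤ n, W ^ i : Submodule 𝕜 A) ≤ C * n ^ D) :
    gkDim 𝕜 A ≤ D := by
  refine iSup₂_le fun W hW => ?_
  obtain ⟨C, hC, h⟩ := hup W hW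
  rw [← (tendsto_log_mul_pow_div_log (Nat.cast_pos.2 hC) D).limsup_eq]
  refine Filter.limsup_le_limsup ?_
  filter_upwards [Filter.eventually_gt_atTop 1] with n hn
  have hn' : (1 : ℝ) < n := Nat.one_lt_cast.2 hn
  refine EReal.coe_le_coe_iff.2 (div_le_div_of_nonneg_right ?_ (Real.log_pos hn').le)
  obtain h0 | hpos := Nat.eq_zero_or_pos (Module.finrank 𝕜 (⨆ i ≤ n, W ^ i : Submodule 𝕜 A))
  · rw [h0, Nat.cast_zero, Real.log_zero]
    exact Real.log_nonneg
      (one_le_mul_of_one_le_of_one_le (Nat.one_le_cast.2 hC) (one_le_pow₀ hn'.le))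
  · exact Real.log_le_log (Nat.cast_pos.2 hpos) (mod_cast h n (zero_lt_one.trans hn))

theorem le_gkDim_of_le_finrank {W : Submodule 𝕜 A} (hW : W.FG) {c : ℝ} (hc : 0 < c)
    (hlow : ∀ n : ℕ, 0 < n →
      c * (n : ℝ) ^ D ≤ Module.finrank 𝕜 (⨆ i ≤ n, W ^ i : Submodule 𝕜 A)) :
    D ≤ gkDim 𝕜 A := by
  refine le_trans ?_ (le_iSup₂_of_le W hW le_rfl)
  rw [← (tendsto_log_mul_pow_div_log hc D).limsup_eq]
  refine Filter.limsup_le_limsup ?_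
  filter_upwards [Filter.eventually_gt_atTop 1] with n hn
  have hn' : (1 : ℝ) < n := Nat.one_lt_cast.2 hn
  exact EReal.coe_le_coe_iff.2 (div_le_div_of_nonneg_right
    (Real.log_le_log (by positivity) (hlow n (zero_lt_one.trans hn))) (Real.log_pos hn').le)

end Growth

section MonomialSpan

variable {𝕜 A : Type*} [Field 𝕜] [Ring A] [Algebra 𝕜 A]

/-- The exponents in `E` of total degree at most `N`. -/
def degreeLE (E : Set (Fin 3 → ℕ)) (N : ℕ) : Set (Fin 3 → ℕ) :=
  {e | e ∈ E ∧ e 0 + e 1 + e 2 ≤ N}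

variable (𝕜) in
/-- The span of the ordered monomials of degree at most `N` with exponents in `E`. -/
def monomialSpan (y : Fin 3 → A) (E : Set (Fin 3 → ℕ)) (N : ℕ) : Submodule 𝕜 A :=
  Submodule.span 𝕜 (orderedMonomial y '' degreeLE E N)

variable (𝕜) in
/-- The generating subspace `⟨1, y₀, y₁, y₂⟩`, whose powers filter the algebra by degree. -/
def generatorSpan (y : Fin 3 → A) : Submodule 𝕜 A := Submodule.span 𝕜 (insert 1 (Set.range y))

variable (𝕜) in
/-- The straightening property: a generator times an ordered monomial with exponent in `E` is a
combination of such monomials, of degree at most one more. -/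
structure Straightens (y : Fin 3 → A) (E : Set (Fin 3 → ℕ)) : Prop where
  zero_mem : 0 ∈ E
  gen_mul_mem (i : Fin 3) {e : Fin 3 → ℕ} (he : e ∈ E) :
    y i * orderedMonomial y e ∈ monomialSpan 𝕜 y E (e 0 + e 1 + e 2 + 1)

variable {y : Fin 3 → A} {E : Set (Fin 3 → ℕ)}

theorem forall_fin_three {P : Fin 3 → Prop} : (∀ i, P i) ↔ P 0 ∧ P 1 ∧ P 2 := by
  rw [Fin.forall_fin_succ, Fin.forall_fin_two]
  rfl

theorem finite_degreeLE (E : Set (Fin 3 → ℕ)) (N : ℕ) : (degreeLE E N).Finite := by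
  refine (Set.finite_Iic fun _ : Fin 3 => N).subset fun e he => ?_
  have hdeg : e 0 + e 1 + e 2 ≤ N := he.2
  exact forall_fin_three.2 ⟨by lia, by lia, by lia⟩

theorem monomialSpan_mono {M N : ℕ} (h : M ≤ N) : monomialSpan 𝕜 y E M ≤ monomialSpan 𝕜 y E N :=
  Submodule.span_mono (Set.image_mono fun _ he => ⟨he.1, he.2.trans h⟩)

theorem orderedMonomial_mem_monomialSpan {e : Fin 3 → ℕ} (he : e ∈ E) {N : ℕ}
    (h : e 0 + e 1 + e 2 ≤ N) : orderedMonomial y e ∈ monomialSpan 𝕜 y E N :=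
  Submodule.subset_span ⟨e, ⟨he, h⟩, rfl⟩

theorem mul_mem_monomialSpan {a : A}
    (h : ∀ e ∈ E, a * orderedMonomial y e ∈ monomialSpan 𝕜 y E (e 0 + e 1 + e 2 + 1))
    {N : ℕ} {f : A} (hf : f ∈ monomialSpan 𝕜 y E N) : a * f ∈ monomialSpan 𝕜 y E (N + 1) := by
  have hle : monomialSpan 𝕜 y E N ≤
      (monomialSpan 𝕜 y E (N + 1)).comap (LinearMap.mulLeft 𝕜 a) := by
    refine Submodule.span_le.2 ?_
    rintro _ ⟨e, ⟨he, hN⟩, rfl⟩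
    exact monomialSpan_mono (Nat.succ_le_succ hN) (h e he)
  exact hle hf

theorem one_le_generatorSpan : 1 ≤ generatorSpan 𝕜 y :=
  Submodule.one_le.2 (Submodule.subset_span (Set.mem_insert _ _))

theorem gen_mem_generatorSpan (i : Fin 3) : y i ∈ generatorSpan 𝕜 y :=
  Submodule.subset_span (Or.inr ⟨i, rfl⟩)

theorem generatorSpan_pow_mono {M N : ℕ} (h : M ≤ N) :
    generatorSpan 𝕜 y ^ M ≤ generatorSpan 𝕜 y ^ N :=
  pow_le_pow_right₀ one_le_generatorSpan h

theorem orderedMonomial_mem_generatorSpan_pow {e : Fin 3 → ℕ} {N : ℕ}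
    (h : e 0 + e 1 + e 2 ≤ N) : orderedMonomial y e ∈ generatorSpan 𝕜 y ^ N := by
  refine generatorSpan_pow_mono h ?_
  have hpow (i : Fin 3) : y i ^ e i ∈ generatorSpan 𝕜 y ^ e i :=
    Submodule.pow_mem_pow _ (gen_mem_generatorSpan i) _
  rw [pow_add, pow_add]
  exact Submodule.mul_mem_mul (Submodule.mul_mem_mul (hpow 0) (hpow 1)) (hpow 2)

theorem Straightens.generatorSpan_pow_eq (h : Straightens 𝕜 y E) (N : ℕ) :
    generatorSpan 𝕜 y ^ N = monomialSpan 𝕜 y E N := by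
  refine le_antisymm ?_ (Submodule.span_le.2 ?_)
  · induction N with
    | zero =>
      rw [pow_zero, Submodule.one_le]
      simpa [orderedMonomial] using
        orderedMonomial_mem_monomialSpan (𝕜 := 𝕜) (y := y) h.zero_mem (N := 0) (by simp)
    | succ N ih =>
      rw [pow_succ', generatorSpan, Submodule.mul_le]
      intro u hu f hf
      have hle : Submodule.span 𝕜 (insert 1 (Set.range y)) ≤
          (monomialSpan 𝕜 y E (N + 1)).comap (LinearMap.mulRight 𝕜 f) := by
        rw [Submodule.span_le, Set.insert_subset_iff, Set.range_subset_iff]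
        refine ⟨?_, fun i => mul_mem_monomialSpan (fun e he => h.gen_mul_mem i he) (ih hf)⟩
        simpa using monomialSpan_mono N.le_succ (ih hf)
      exact hle hu
  · rintro _ ⟨e, ⟨-, hN⟩, rfl⟩
    exact orderedMonomial_mem_generatorSpan_pow hN

theorem exists_mem_generatorSpan_pow (hy : Algebra.adjoin 𝕜 (Set.range y) = ⊤) (f : A) :
    ∃ N, f ∈ generatorSpan 𝕜 y ^ N := by
  have hf : f ∈ Algebra.adjoin 𝕜 (Set.range y) := hy ▸ Algebra.mem_top
  induction hf using Algebra.adjoin_induction with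
  | mem f hf => exact ⟨1, by rw [pow_one]; exact Submodule.subset_span (Or.inr hf)⟩
  | algebraMap c => exact ⟨0, by rw [pow_zero]; exact Submodule.algebraMap_mem c⟩
  | add f g _ _ hf hg =>
    obtain ⟨M, hM⟩ := hf
    obtain ⟨N, hN⟩ := hg
    exact ⟨max M N, Submodule.add_mem _ (generatorSpan_pow_mono (le_max_left _ _) hM)
      (generatorSpan_pow_mono (le_max_right _ _) hN)⟩
  | mul f g _ _ hf hg =>
    obtain ⟨M, hM⟩ := hf
    obtain ⟨N, hN⟩ := hg
    exact ⟨M + N, by rw [pow_add]; exact Submodule.mul_mem_mul hM hN⟩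

theorem exists_le_generatorSpan_pow (hy : Algebra.adjoin 𝕜 (Set.range y) = ⊤)
    {W : Submodule 𝕜 A} (hW : W.FG) : ∃ N, W ≤ generatorSpan 𝕜 y ^ N := by
  obtain ⟨s, rfl⟩ := hW
  choose N hN using exists_mem_generatorSpan_pow (𝕜 := 𝕜) hy
  exact ⟨s.sup N, Submodule.span_le.2 fun f hf =>
    generatorSpan_pow_mono (Finset.le_sup (f := N) hf) (hN f)⟩

theorem Straightens.span_orderedMonomial_eq_top (h : Straightens 𝕜 y E)
    (hy : Algebra.adjoin 𝕜 (Set.range y) = ⊤) :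
    Submodule.span 𝕜 (orderedMonomial y '' E) = ⊤ := by
  refine eq_top_iff.2 fun f _ => ?_
  obtain ⟨N, hN⟩ := exists_mem_generatorSpan_pow (𝕜 := 𝕜) hy f
  rw [h.generatorSpan_pow_eq] at hN
  exact Submodule.span_mono (Set.image_mono fun _ he => he.1) hN

theorem iSup_pow_le_generatorSpan_pow {W : Submodule 𝕜 A} {m : ℕ}
    (hW : W ≤ generatorSpan 𝕜 y ^ m) (n : ℕ) : ⨆ i ≤ n, W ^ i ≤ generatorSpan 𝕜 y ^ (m * n) :=
  iSup₂_le fun i hi => calc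
    W ^ i ≤ (generatorSpan 𝕜 y ^ m) ^ i := pow_le_pow_left₀ bot_le hW i
    _ = generatorSpan 𝕜 y ^ (m * i) := (pow_mul _ _ _).symm
    _ ≤ generatorSpan 𝕜 y ^ (m * n) := generatorSpan_pow_mono (Nat.mul_le_mul_left _ hi)

theorem finite_monomialSpan (N : ℕ) : Module.Finite 𝕜 (monomialSpan 𝕜 y E N) :=
  FiniteDimensional.span_of_finite 𝕜 ((finite_degreeLE E N).image _)

theorem finrank_monomialSpan (hind : LinearIndepOn 𝕜 (orderedMonomial y) E) (N : ℕ) :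
    Module.finrank 𝕜 (monomialSpan 𝕜 y E N) = (degreeLE E N).ncard := by
  have := (finite_degreeLE E N).fintype
  have hli : LinearIndepOn 𝕜 (orderedMonomial y) (degreeLE E N) := hind.mono fun _ he => he.1
  rw [monomialSpan, Set.image_eq_range, finrank_span_eq_card hli, Set.ncard_eq_toFinset_card',
    Set.toFinset_card]

theorem Straightens.gkDim_eq (h : Straightens 𝕜 y E)
    (hy : Algebra.adjoin 𝕜 (Set.range y) = ⊤) (hind : LinearIndepOn 𝕜 (orderedMonomial y) E)
    {D K : ℕ} (hK : 0 < K) (hup : ∀ N, (degreeLE E N).ncard ≤ K * (N + 1) ^ D)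
    {c : ℝ} (hc : 0 < c) (hlow : ∀ N : ℕ, c * (N : ℝ) ^ D ≤ (degreeLE E N).ncard) :
    gkDim 𝕜 A = D := by
  refine le_antisymm (gkDim_le_of_finrank_le fun W hW => ?_)
    (le_gkDim_of_le_finrank (Submodule.fg_span ((Set.finite_range y).insert 1)) hc
      fun n _ => (hlow n).trans ?_)
  · obtain ⟨m, hm⟩ := exists_le_generatorSpan_pow hy hW
    refine ⟨K * (m + 1) ^ D, by positivity, fun n hn => ?_⟩
    have := finite_monomialSpan (𝕜 := 𝕜) (y := y) (E := E) (m * n)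
    calc Module.finrank 𝕜 (⨆ i ≤ n, W ^ i : Submodule 𝕜 A)
        ≤ Module.finrank 𝕜 (monomialSpan 𝕜 y E (m * n)) :=
          Submodule.finrank_mono
            ((iSup_pow_le_generatorSpan_pow hm n).trans (h.generatorSpan_pow_eq _).le)
      _ ≤ K * (m * n + 1) ^ D := (finrank_monomialSpan hind _).trans_le (hup _)
      _ ≤ K * ((m + 1) * n) ^ D := by gcongr; lia
      _ = K * (m + 1) ^ D * n ^ D := by rw [mul_pow, mul_assoc]
  · have hsup : ⨆ i ≤ n, generatorSpan 𝕜 y ^ i = monomialSpan 𝕜 y E n := by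
      rw [← h.generatorSpan_pow_eq]
      exact le_antisymm (iSup₂_le fun i hi => generatorSpan_pow_mono hi)
        (le_iSup₂_of_le n le_rfl le_rfl)
    change _ ≤ (Module.finrank 𝕜 (⨆ i ≤ n, generatorSpan 𝕜 y ^ i : Submodule 𝕜 A) : ℝ)
    rw [hsup, finrank_monomialSpan hind]

end MonomialSpan

/-! ### The ordered monomials span -/

section Straightening

variable {𝕜 A : Type*} [Field 𝕜] [Ring A] [Algebra 𝕜 A] {y : Fin 3 → A} {E : Set (Fin 3 → ℕ)}

theorem pow_mul_pow_mul_pow_mem_monomialSpan {i j l N : ℕ} (he : ![i, j, l] ∈ E)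
    (h : i + j + l ≤ N) : y 0 ^ i * (y 1 ^ j * y 2 ^ l) ∈ monomialSpan 𝕜 y E N := by
  rw [← mul_assoc]
  exact orderedMonomial_mem_monomialSpan (y := y) (e := ![i, j, l]) he h

theorem mul_pow_mul_mem_monomialSpan {u v : A}
    (hv : ∀ ⦃N f⦄, f ∈ monomialSpan 𝕜 y E N → v * f ∈ monomialSpan 𝕜 y E (N + 1))
    (huv : ∀ ⦃N f⦄, f ∈ monomialSpan 𝕜 y E N → u * f ∈ monomialSpan 𝕜 y E (N + 1) →
      u * (v * f) ∈ monomialSpan 𝕜 y E (N + 1 + 1))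
    {N : ℕ} {f : A} (hf : f ∈ monomialSpan 𝕜 y E N) (huf : u * f ∈ monomialSpan 𝕜 y E (N + 1))
    (n : ℕ) : u * (v ^ n * f) ∈ monomialSpan 𝕜 y E (N + n + 1) := by
  have hpow (n : ℕ) : v ^ n * f ∈ monomialSpan 𝕜 y E (N + n) := by
    induction n with
    | zero => simpa using hf
    | succ n ih => rw [pow_succ', mul_assoc]; exact hv ih
  induction n with
  | zero => simpa using huf
  | succ n ih => rw [pow_succ', mul_assoc]; exact huv (hpow n) ih

theorem mul_gen_zero_mul_mem_monomialSpan {u : A} {α β : 𝕜}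
    (hu : u * y 0 = α • (y 0 * u) + β • (y 0 * y 0))
    (h0 : ∀ ⦃N f⦄, f ∈ monomialSpan 𝕜 y E N → y 0 * f ∈ monomialSpan 𝕜 y E (N + 1))
    {N : ℕ} {f : A} (hf : f ∈ monomialSpan 𝕜 y E N) (huf : u * f ∈ monomialSpan 𝕜 y E (N + 1)) :
    u * (y 0 * f) ∈ monomialSpan 𝕜 y E (N + 1 + 1) := by
  rw [← mul_assoc, hu, add_mul, smul_mul_assoc, smul_mul_assoc, mul_assoc, mul_assoc]
  exact add_mem (Submodule.smul_mem _ _ (h0 huf)) (Submodule.smul_mem _ _ (h0 (h0 hf)))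

theorem gen_two_mul_gen_one_mul_mem_monomialSpan {α β γ δ : 𝕜}
    (h21 : y 2 * y 1 = α • (y 1 * y 2) + β • (y 0 * y 2) + γ • (y 0 * y 1) + δ • (y 0 * y 0))
    (h0 : ∀ ⦃N f⦄, f ∈ monomialSpan 𝕜 y E N → y 0 * f ∈ monomialSpan 𝕜 y E (N + 1))
    (h1 : ∀ ⦃N f⦄, f ∈ monomialSpan 𝕜 y E N → y 1 * f ∈ monomialSpan 𝕜 y E (N + 1))
    {N : ℕ} {f : A} (hf : f ∈ monomialSpan 𝕜 y E N)
    (h2f : y 2 * f ∈ monomialSpan 𝕜 y E (N + 1)) :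
    y 2 * (y 1 * f) ∈ monomialSpan 𝕜 y E (N + 1 + 1) := by
  rw [← mul_assoc, h21]
  simp only [add_mul, smul_mul_assoc, mul_assoc]
  refine add_mem (add_mem (add_mem ?_ ?_) ?_) ?_ <;> refine Submodule.smul_mem _ _ ?_
  exacts [h1 h2f, h0 h2f, h0 (h1 hf), h0 (h0 hf)]

theorem straightens_of_triangular (h_zero : 0 ∈ E) (hE : IsLowerSet E) {α₁ β₁ α₂ β₂ α β γ δ : 𝕜}
    (h10 : y 1 * y 0 = α₁ • (y 0 * y 1) + β₁ • (y 0 * y 0))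
    (h20 : y 2 * y 0 = α₂ • (y 0 * y 2) + β₂ • (y 0 * y 0))
    (h21 : y 2 * y 1 = α • (y 1 * y 2) + β • (y 0 * y 2) + γ • (y 0 * y 1) + δ • (y 0 * y 0))
    (hpow0 : ∀ i j l, ![i, j, l] ∈ E →
      y 0 ^ (i + 1) * (y 1 ^ j * y 2 ^ l) ∈ monomialSpan 𝕜 y E (l + j + i + 1))
    (hpow1 : ∀ j l, ![0, j, l] ∈ E → y 1 ^ (j + 1) * y 2 ^ l ∈ monomialSpan 𝕜 y E (l + j + 1))
    (hpow2 : ∀ l, ![0, 0, l] ∈ E → y 2 ^ (l + 1) ∈ monomialSpan 𝕜 y E (l + 1)) :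
    Straightens 𝕜 y E := by
  have hE1 {e} (he : e ∈ E) : ![0, e 1, e 2] ∈ E :=
    hE (show ![0, e 1, e 2] ≤ e from forall_fin_three.2 ⟨Nat.zero_le _, le_rfl, le_rfl⟩) he
  have hE2 {e} (he : e ∈ E) : ![0, 0, e 2] ∈ E :=
    hE (show ![0, 0, e 2] ≤ e from forall_fin_three.2 ⟨Nat.zero_le _, Nat.zero_le _, le_rfl⟩) he
  have hmem1 {e} (he : e ∈ E) : y 1 ^ e 1 * y 2 ^ e 2 ∈ monomialSpan 𝕜 y E (e 2 + e 1) := by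
    simpa using pow_mul_pow_mul_pow_mem_monomialSpan (hE1 he) (by lia)
  have hmem2 {e} (he : e ∈ E) : y 2 ^ e 2 ∈ monomialSpan 𝕜 y E (e 2) := by
    simpa using pow_mul_pow_mul_pow_mem_monomialSpan (hE2 he) (by lia)
  have hdeg (e : Fin 3 → ℕ) : e 0 + e 1 + e 2 + 1 = e 2 + e 1 + e 0 + 1 := by ring
  have gen_zero (e) (he : e ∈ E) :
      y 0 * orderedMonomial y e ∈ monomialSpan 𝕜 y E (e 0 + e 1 + e 2 + 1) := by
    rw [hdeg, orderedMonomial, mul_assoc (y 0 ^ e 0), ← mul_assoc, ← pow_succ']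
    exact hpow0 _ _ _
      (hE (show ![e 0, e 1, e 2] ≤ e from forall_fin_three.2 ⟨le_rfl, le_rfl, le_rfl⟩) he)
  have h0 ⦃N f⦄ (hf : f ∈ monomialSpan 𝕜 y E N) := mul_mem_monomialSpan gen_zero hf
  have gen_one (e) (he : e ∈ E) :
      y 1 * orderedMonomial y e ∈ monomialSpan 𝕜 y E (e 0 + e 1 + e 2 + 1) := by
    rw [hdeg, orderedMonomial, mul_assoc (y 0 ^ e 0)]
    refine mul_pow_mul_mem_monomialSpan h0
      (fun _ _ => mul_gen_zero_mul_mem_monomialSpan h10 h0) (hmem1 he) ?_ _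
    rw [← mul_assoc, ← pow_succ']
    exact hpow1 _ _ (hE1 he)
  have h1 ⦃N f⦄ (hf : f ∈ monomialSpan 𝕜 y E N) := mul_mem_monomialSpan gen_one hf
  have gen_two (e) (he : e ∈ E) :
      y 2 * orderedMonomial y e ∈ monomialSpan 𝕜 y E (e 0 + e 1 + e 2 + 1) := by
    rw [hdeg, orderedMonomial, mul_assoc (y 0 ^ e 0)]
    refine mul_pow_mul_mem_monomialSpan h0
      (fun _ _ => mul_gen_zero_mul_mem_monomialSpan h20 h0) (hmem1 he) ?_ _
    refine mul_pow_mul_mem_monomialSpan h1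
      (fun _ _ => gen_two_mul_gen_one_mul_mem_monomialSpan h21 h0 h1) (hmem2 he) ?_ _
    rw [← pow_succ']
    exact hpow2 _ (hE2 he)
  exact ⟨h_zero, forall_fin_three.2 ⟨@gen_zero, @gen_one, @gen_two⟩⟩

end Straightening

/-! ### Nichols algebras with a basis of ordered monomials -/

section Assembly

variable {𝕜 : Type*} [Field 𝕜]

theorem adjoin_range_mkₐ_ι {X : Type*} (I : TwoSidedIdeal (FreeAlgebra 𝕜 X)) :
    Algebra.adjoin 𝕜 (Set.range fun i => I.ringCon.mkₐ 𝕜 (FreeAlgebra.ι 𝕜 i)) = ⊤ := by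
  have himage : (Set.range fun i => I.ringCon.mkₐ 𝕜 (FreeAlgebra.ι 𝕜 i)) =
      I.ringCon.mkₐ 𝕜 '' Set.range (FreeAlgebra.ι 𝕜) := Set.range_comp _ _
  rw [himage, ← AlgHom.map_adjoin, FreeAlgebra.adjoin_range_ι, Algebra.map_top]
  exact (AlgHom.range_eq_top _).2 (RingCon.mkₐ_surjective _)

theorem map_linearCombination_orderedMonomial {A B : Type*} [Ring A] [Algebra 𝕜 A] [Ring B]
    [Algebra 𝕜 B] (φ : A →ₐ[𝕜] B) (y : Fin 3 → A) (c : (Fin 3 → ℕ) →₀ 𝕜) :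
    φ (Finsupp.linearCombination 𝕜 (orderedMonomial y) c) =
      Finsupp.linearCombination 𝕜 (orderedMonomial fun i => φ (y i)) c := by
  simp only [Finsupp.linearCombination_apply, Finsupp.sum, map_sum, map_smul, orderedMonomial,
    map_mul, map_pow]

variable {r : Fin 3 → Fin 3 → Fin 3 → Fin 3 → 𝕜} {E : Set (Fin 3 → ℕ)}

theorem nicholsIdeal_eq_of_orderedMonomial {I : TwoSidedIdeal (FreeAlgebra 𝕜 (Fin 3))}
    (hI : IsHopfIdeal r I)
    (hspan : Submodule.span 𝕜
      (orderedMonomial (fun i => I.ringCon.mkₐ 𝕜 (FreeAlgebra.ι 𝕜 i)) '' E) = ⊤)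
    (hind : LinearIndepOn 𝕜 (orderedMonomial (gen r)) E) : nicholsIdeal r = I := by
  have hIJ : I ≤ nicholsIdeal r := (nicholsIdeal_isGreatest r).2 hI
  refine le_antisymm (fun f hf => ?_) hIJ
  obtain ⟨c, hc, hcf⟩ := (Finsupp.mem_span_image_iff_linearCombination 𝕜).1
    (hspan.symm ▸ Submodule.mem_top : I.ringCon.mkₐ 𝕜 f ∈ _)
  let g := Finsupp.linearCombination 𝕜 (orderedMonomial (FreeAlgebra.ι 𝕜)) c
  have hfg : f - g ∈ I := by
    rw [← mkₐ_eq_zero_iff, map_sub, map_linearCombination_orderedMonomial, hcf, sub_self]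
  have hg : Finsupp.linearCombination 𝕜 (orderedMonomial (gen r)) c = 0 := calc
    _ = proj r g := by simp only [g, map_linearCombination_orderedMonomial, proj_ι]
    _ = proj r f - proj r (f - g) := by rw [map_sub, sub_sub_cancel]
    _ = 0 := by rw [(proj_eq_zero_iff r).2 hf, (proj_eq_zero_iff r).2 (hIJ hfg), sub_zero]
  have hc0 : c = 0 := linearIndepOn_iff.1 hind c hc hg
  simpa only [g, hc0, map_zero, sub_zero] using hfg

theorem isMonomialBasis_of_orderedMonomial
    (hspan : Submodule.span 𝕜 (orderedMonomial (gen r) '' E) = ⊤)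
    (hind : LinearIndepOn 𝕜 (orderedMonomial (gen r)) E) : IsMonomialBasis r E := by
  refine ⟨Module.Basis.mk hind ?_, fun e => Module.Basis.mk_apply _ _ _⟩
  rw [← Set.image_eq_range, hspan]

theorem nicholsIdeal_eq_and_isMonomialBasis_and_gkDim_eq {R : Set (FreeAlgebra 𝕜 (Fin 3))}
    (hR : IsHopfIdeal r (TwoSidedIdeal.span R))
    (hstr : ∀ I : TwoSidedIdeal (FreeAlgebra 𝕜 (Fin 3)), (∀ s ∈ R, I.ringCon.mkₐ 𝕜 s = 0) →
      Straightens 𝕜 (fun i => I.ringCon.mkₐ 𝕜 (FreeAlgebra.ι 𝕜 i)) E)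
    (hind : LinearIndepOn 𝕜 (orderedMonomial (gen r)) E)
    {D K : ℕ} (hK : 0 < K) (hup : ∀ N, (degreeLE E N).ncard ≤ K * (N + 1) ^ D)
    {c : ℝ} (hc : 0 < c) (hlow : ∀ N : ℕ, c * (N : ℝ) ^ D ≤ (degreeLE E N).ncard) :
    nicholsIdeal r = TwoSidedIdeal.span R ∧ IsMonomialBasis r E ∧
      gkDim 𝕜 (NicholsAlgebra r) = D := by
  have hgen : Straightens 𝕜 (gen r) E := hstr (nicholsIdeal r) fun s hs =>
    (mkₐ_eq_zero_iff _).2 ((nicholsIdeal_isGreatest r).2 hR (TwoSidedIdeal.subset_span hs))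
  have hadj : Algebra.adjoin 𝕜 (Set.range (gen r)) = ⊤ := adjoin_range_mkₐ_ι (nicholsIdeal r)
  refine ⟨nicholsIdeal_eq_of_orderedMonomial hR (Straightens.span_orderedMonomial_eq_top ?_
      (adjoin_range_mkₐ_ι _)) hind,
    isMonomialBasis_of_orderedMonomial (hgen.span_orderedMonomial_eq_top hadj) hind,
    hgen.gkDim_eq hadj hind hK hup hc hlow⟩
  exact hstr _ fun s hs => (mkₐ_eq_zero_iff _).2 (TwoSidedIdeal.subset_span hs)

end Assembly

section Counting

variable {E : Set (Fin 3 → ℕ)} {N : ℕ} {s : Fin 3 → Finset ℕ}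

theorem ncard_le_of_subset_piFinset {S : Set (Fin 3 → ℕ)} (h : S ⊆ Fintype.piFinset s) :
    S.ncard ≤ (s 0).card * (s 1).card * (s 2).card := by
  rw [← Fin.prod_univ_three fun i => (s i).card, ← Fintype.card_piFinset, ← Set.ncard_coe_finset]
  exact Set.ncard_le_ncard h (Finset.finite_toSet _)

theorem le_ncard_degreeLE_of_piFinset_subset (h : ↑(Fintype.piFinset s) ⊆ degreeLE E N) :
    (s 0).card * (s 1).card * (s 2).card ≤ (degreeLE E N).ncard := by
  rw [← Fin.prod_univ_three fun i => (s i).card, ← Fintype.card_piFinset, ← Set.ncard_coe_finset]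
  exact Set.ncard_le_ncard h (finite_degreeLE E N)

theorem ncard_degreeLE_expB3_le (N : ℕ) : (degreeLE expB3 N).ncard ≤ 1 * (N + 1) ^ 3 := by
  have h := ncard_le_of_subset_piFinset (S := degreeLE expB3 N) (s := fun _ => Finset.range (N + 1))
    fun e he => by
      have hdeg : e 0 + e 1 + e 2 ≤ N := he.2
      simp only [Finset.mem_coe, Fintype.mem_piFinset, Finset.mem_range]
      exact forall_fin_three.2 ⟨by lia, by lia, by lia⟩
  rw [Finset.card_range] at h
  linarith

theorem le_ncard_degreeLE_expB3 (N : ℕ) :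
    1 / 27 * (N : ℝ) ^ 3 ≤ (degreeLE expB3 N).ncard := by
  have h := le_ncard_degreeLE_of_piFinset_subset (E := expB3) (N := N)
    (s := fun _ => Finset.range (N / 3 + 1)) fun e he => by
      simp only [Finset.mem_coe, Fintype.mem_piFinset, Finset.mem_range] at he
      exact ⟨Set.mem_univ e, by have := he 0; have := he 1; have := he 2; lia⟩
  rw [Finset.card_range] at h
  have hN : (N : ℝ) / 3 ≤ (N / 3 + 1 : ℕ) := by
    rw [div_le_iff₀ three_pos]
    exact_mod_cast (by lia : N ≤ (N / 3 + 1) * 3)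
  calc 1 / 27 * (N : ℝ) ^ 3 = ((N : ℝ) / 3) ^ 3 := by ring
    _ ≤ ((N / 3 + 1 : ℕ) : ℝ) ^ 3 := by gcongr
    _ = ((N / 3 + 1) * (N / 3 + 1) * (N / 3 + 1) : ℕ) := by push_cast; ring
    _ ≤ (degreeLE expB3 N).ncard := Nat.cast_le.2 h

theorem ncard_degreeLE_expB1_le (N : ℕ) : (degreeLE expB1 N).ncard ≤ 4 * (N + 1) ^ 1 := by
  have h := ncard_le_of_subset_piFinset (S := degreeLE expB1 N)
    (s := ![Finset.range 2, Finset.range 2, Finset.range (N + 1)]) fun e he => by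
      obtain ⟨⟨h0, h1⟩, hdeg⟩ := he
      exact Fintype.mem_piFinset.2 (forall_fin_three.2 ⟨Finset.mem_range.2 h0,
        Finset.mem_range.2 h1, Finset.mem_range.2 (by lia)⟩)
  simpa using h

theorem le_ncard_degreeLE_expB1 (N : ℕ) : 1 * (N : ℝ) ^ 1 ≤ (degreeLE expB1 N).ncard := by
  have h := le_ncard_degreeLE_of_piFinset_subset (E := expB1) (N := N)
    (s := ![{0}, {0}, Finset.range (N + 1)]) fun e he => by
      obtain ⟨h0, h1, h2⟩ := forall_fin_three.1 (Fintype.mem_piFinset.1 he)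
      replace h0 : e 0 = 0 := Finset.mem_singleton.1 h0
      replace h1 : e 1 = 0 := Finset.mem_singleton.1 h1
      replace h2 : e 2 < N + 1 := Finset.mem_range.1 h2
      exact ⟨⟨by lia, by lia⟩, by lia⟩
  have hN : N ≤ (degreeLE expB1 N).ncard := by
    refine N.le_succ.trans ?_
    simpa using h
  rw [one_mul, pow_one]
  exact Nat.cast_le.2 hN

theorem expB0_eq_piFinset :
    expB0 = (Fintype.piFinset fun _ : Fin 3 => Finset.range 2 : Finset (Fin 3 → ℕ)) := by
  ext e
  simp [expB0]

theorem ncard_degreeLE_expB0_le (N : ℕ) : (degreeLE expB0 N).ncard ≤ 8 * (N + 1) ^ 0 :=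
  ncard_le_of_subset_piFinset (s := fun _ => Finset.range 2) fun _ he => expB0_eq_piFinset ▸ he.1

theorem le_ncard_degreeLE_expB0 (N : ℕ) : 1 * (N : ℝ) ^ 0 ≤ (degreeLE expB0 N).ncard := by
  have hzero : (0 : Fin 3 → ℕ) ∈ degreeLE expB0 N := by simp [degreeLE, expB0]
  rw [pow_zero, mul_one]
  exact Nat.one_le_cast.2 ((Set.ncard_pos (finite_degreeLE _ _)).2 ⟨0, hzero⟩)

theorem finrank_of_isMonomialBasis_expB0 {𝕜 : Type*} [Field 𝕜]
    {r : Fin 3 → Fin 3 → Fin 3 → Fin 3 → 𝕜} (h : IsMonomialBasis r expB0) :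
    Module.finrank 𝕜 (NicholsAlgebra r) = 8 := by
  obtain ⟨β, -⟩ := h
  rw [Module.finrank_eq_nat_card_basis β, expB0_eq_piFinset, Nat.card_coe_set_eq,
    Set.ncard_coe_finset, Fintype.card_piFinset_const, Finset.card_range]
  rfl

end Counting

end Nichols

namespace R17

open Nichols

variable {𝕜 : Type*} [Field 𝕜]

/-! ### The relations of `ℜ_{1,7}` generate Hopf ideals -/

section Slices

variable (t a b d k ℓ p q : 𝕜)

theorem outerSlice_braiding (i l : Fin 3) : outerSlice (braiding t a b d k ℓ p q) i l =
    ![![!![t, 0, 0; -(t * k), t, 0; t * a, 0, t], 0, 0],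
      ![!![t * k, 0, 0; -(t * k * ℓ), t * ℓ, 0; t * (k * (a - q) - d), 0, t * k],
        !![t, 0, 0; -(t * ℓ), t, 0; t * a, 0, t], 0],
      ![!![t * p, 0, 0; t * d, t * q, 0; t * b, 0, t * p],
        !![0, 0, 0; t * (p - q), 0, 0; 0, 0, 0],
        !![t, 0, 0; -(t * k), t, 0; t * a, 0, t]]] i l := by
  ext j m
  fin_cases i <;> fin_cases l <;> fin_cases j <;> fin_cases m <;> rfl

theorem innerSlice_braiding (n m : Fin 3) : innerSlice (braiding t a b d k ℓ p q) n m =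
    ![![!![t, 0, 0; t * k, t, 0; t * p, 0, t], 0, 0],
      ![!![-(t * k), 0, 0; -(t * k * ℓ), -(t * ℓ), 0; t * d, t * (p - q), -(t * k)],
        !![t, 0, 0; t * ℓ, t, 0; t * q, 0, t], 0],
      ![!![t * a, 0, 0; t * (k * (a - q) - d), t * a, 0; t * b, 0, t * a],
        0, !![t, 0, 0; t * k, t, 0; t * p, 0, t]]] n m := by
  ext i l
  fin_cases n <;> fin_cases m <;> fin_cases i <;> fin_cases l <;> rfl

theorem braiding_eq_outerSlice (i j m n : Fin 3) :
    braiding t a b d k ℓ p q i j m n = outerSlice (braiding t a b d k ℓ p q) i n j m := rfl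

theorem braiding_eq_zero_of_lt (i j m l : Fin 3) (hil : i < l) :
    braiding t a b d k ℓ p q i j m l = 0 := by
  fin_cases i <;> fin_cases l <;> first
    | exact absurd hil (by decide)
    | (fin_cases j <;> fin_cases m <;> rfl)

theorem braiding_eq_zero_of_le_of_lt (n i j m l : Fin 3) (hj : j ≤ n) (hm : n < m) :
    braiding t a b d k ℓ p q i j m l = 0 := by
  have hjm : j < m := hj.trans_lt hm
  fin_cases j <;> fin_cases m <;> first
    | exact absurd hjm (by decide)
    | (fin_cases i <;> fin_cases l <;> rfl)

end Slices

/-- The coefficient matrices of the elements of `relA`. -/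
def relMatrixA (d k q : 𝕜) : Fin 3 → Matrix (Fin 3) (Fin 3) 𝕜 :=
  ![!![-k, -1, 0; 1, 0, 0; 0, 0, 0],
    !![-q, 0, -1; 0, 0, 0; 1, 0, 0],
    !![-(d + q * k), -q, k; 0, 0, -1; 0, 1, 0]]

/-- The coefficient matrices of the elements of `relB`. -/
def relMatrixB (k ℓ q : 𝕜) : Fin 5 → Matrix (Fin 3) (Fin 3) 𝕜 :=
  ![!![0, 1, 0; 1, 0, 0; 0, 0, 0],
    !![0, 0, 1; 0, 0, 0; 1, 0, 0],
    !![0, -q, -k; 0, 0, 1; 0, 1, 0],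
    !![1, 0, 0; 0, 0, 0; 0, 0, 0],
    !![0, -ℓ, 0; 0, 1, 0; 0, 0, 0]]

/-- The coefficient matrices of the elements of `relC`. -/
def relMatrixC (k ℓ p q : 𝕜) : Fin 6 → Matrix (Fin 3) (Fin 3) 𝕜 :=
  Matrix.vecCons !![0, 0, -p; 0, 0, 0; 0, 0, 1] (relMatrixB k ℓ q)

theorem quad_image_range_relMatrixA (d k q : 𝕜) :
    quad '' Set.range (relMatrixA d k q) = relA d k q := by
  simp only [relMatrixA, relA, Matrix.range_cons, Matrix.range_empty, Set.image_insert_eq,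
    Set.image_singleton, Set.union_empty, Set.singleton_union]
  congr! 3 <;> simp [quad_apply, Fin.sum_univ_three, pow_two] <;> module

theorem quad_image_range_relMatrixB (k ℓ q : 𝕜) :
    quad '' Set.range (relMatrixB k ℓ q) = relB k ℓ q := by
  simp only [relMatrixB, relB, Matrix.range_cons, Matrix.range_empty, Set.image_insert_eq,
    Set.image_singleton, Set.union_empty, Set.singleton_union]
  congr! 5 <;> simp [quad_apply, Fin.sum_univ_three, pow_two] <;> module

theorem quad_image_range_relMatrixC (k ℓ p q : 𝕜) :
    quad '' Set.range (relMatrixC k ℓ p q) = relC k ℓ p q := by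
  rw [relMatrixC, Matrix.range_cons, Set.image_union, quad_image_range_relMatrixB,
    Set.image_singleton, Set.union_comm, relC]
  congr! 2
  simp [quad_apply, Fin.sum_univ_three, pow_two]
  module

section Span

variable {d k ℓ p q : 𝕜} {S : Matrix (Fin 3) (Fin 3) 𝕜}

theorem mem_span_relMatrixA : S ∈ Submodule.span 𝕜 (Set.range (relMatrixA d k q)) ↔
    S 1 1 = 0 ∧ S 2 2 = 0 ∧ S 1 2 = -S 2 1 ∧ S 0 1 = -S 1 0 - q * S 2 1 ∧
    S 0 2 = -S 2 0 + k * S 2 1 ∧ S 0 0 = -(k * S 1 0) - q * S 2 0 - (d + q * k) * S 2 1 := by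
  rw [Submodule.mem_span_range_iff_exists_fun]
  constructor
  · rintro ⟨c, rfl⟩
    refine ⟨?_, ?_, ?_, ?_, ?_, ?_⟩ <;> simp [Fin.sum_univ_three, relMatrixA] <;> ring
  · rintro ⟨h11, h22, h12, h01, h02, h00⟩
    refine ⟨![S 1 0, S 2 0, S 2 1], ?_⟩
    ext i j
    fin_cases i <;> fin_cases j <;>
      simp [Fin.sum_univ_three, relMatrixA, h11, h22, h12, h01, h02, h00] <;> ring

theorem mem_span_relMatrixB : S ∈ Submodule.span 𝕜 (Set.range (relMatrixB k ℓ q)) ↔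
    S 2 2 = 0 ∧ S 1 2 = S 2 1 ∧ S 0 2 = S 2 0 - k * S 2 1 ∧
    S 0 1 = S 1 0 - q * S 2 1 - ℓ * S 1 1 := by
  rw [Submodule.mem_span_range_iff_exists_fun]
  constructor
  · rintro ⟨c, rfl⟩
    refine ⟨?_, ?_, ?_, ?_⟩ <;> simp [Fin.sum_univ_five, relMatrixB] <;> ring
  · rintro ⟨h22, h12, h02, h01⟩
    refine ⟨![S 1 0, S 2 0, S 2 1, S 0 0, S 1 1], ?_⟩
    ext i j
    fin_cases i <;> fin_cases j <;>
      simp [Fin.sum_univ_five, relMatrixB, h22, h12, h02, h01] <;> ring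

theorem mem_span_relMatrixC : S ∈ Submodule.span 𝕜 (Set.range (relMatrixC k ℓ p q)) ↔
    S 1 2 = S 2 1 ∧ S 0 2 = S 2 0 - k * S 2 1 - p * S 2 2 ∧
    S 0 1 = S 1 0 - q * S 2 1 - ℓ * S 1 1 := by
  rw [Submodule.mem_span_range_iff_exists_fun]
  constructor
  · rintro ⟨c, rfl⟩
    refine ⟨?_, ?_, ?_⟩ <;> simp [Fin.sum_univ_six, relMatrixC, relMatrixB] <;> ring
  · rintro ⟨h12, h02, h01⟩
    refine ⟨![S 2 2, S 1 0, S 2 0, S 2 1, S 0 0, S 1 1], ?_⟩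
    ext i j
    fin_cases i <;> fin_cases j <;>
      simp [Fin.sum_univ_six, relMatrixC, relMatrixB, h12, h02, h01] <;> ring

end Span

section Primitive

variable (b d k ℓ p q : 𝕜)

set_option maxHeartbeats 1000000 in
-- the three fields are settled by nine entrywise computations each
theorem isBraidedPrimitive_relMatrixA : IsBraidedPrimitive (braiding 1 (p - 2 * q) b d k ℓ p q)
    (Submodule.span 𝕜 (Set.range (relMatrixA d k q))) where
  braiding_eq_neg S hS m n := by
    obtain ⟨h11, h22, h12, h01, h02, h00⟩ := mem_span_relMatrixA.1 hS
    fin_cases m <;> fin_cases n <;> simp only [Fin.sum_univ_three,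
      Fin.zero_eta, Fin.mk_one, Fin.reduceFinMk,
      braiding_eq_outerSlice, outerSlice_braiding, Matrix.cons_val, Matrix.of_apply,
      Matrix.zero_apply, h11, h22, h12, h01, h02, h00] <;> ring
  outer_mem S hS i l := by
    obtain ⟨h11, h22, h12, h01, h02, h00⟩ := mem_span_relMatrixA.1 hS
    rw [mem_span_relMatrixA]
    fin_cases i <;> fin_cases l <;> simp only [Fin.sum_univ_three,
      Fin.zero_eta, Fin.mk_one, Fin.reduceFinMk,
      outerSlice_braiding, Matrix.cons_val, Matrix.add_apply, Matrix.mul_apply,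
      Matrix.transpose_apply, Matrix.of_apply, Matrix.zero_apply, h11, h22, h12, h01, h02, h00] <;>
      refine ⟨?_, ?_, ?_, ?_, ?_, ?_⟩ <;> ring
  inner_mem S hS n m := by
    obtain ⟨h11, h22, h12, h01, h02, h00⟩ := mem_span_relMatrixA.1 hS
    rw [mem_span_relMatrixA]
    fin_cases n <;> fin_cases m <;> simp only [Fin.sum_univ_three,
      Fin.zero_eta, Fin.mk_one, Fin.reduceFinMk,
      innerSlice_braiding, Matrix.cons_val, Matrix.add_apply, Matrix.mul_apply,
      Matrix.transpose_apply, Matrix.of_apply, Matrix.zero_apply, h11, h22, h12, h01, h02, h00] <;>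
      refine ⟨?_, ?_, ?_, ?_, ?_, ?_⟩ <;> ring

set_option maxHeartbeats 1000000 in
-- the three fields are settled by nine entrywise computations each
theorem isBraidedPrimitive_relMatrixB : IsBraidedPrimitive (braiding (-1) (-p) b d k ℓ p q)
    (Submodule.span 𝕜 (Set.range (relMatrixB k ℓ q))) where
  braiding_eq_neg S hS m n := by
    obtain ⟨h22, h12, h02, h01⟩ := mem_span_relMatrixB.1 hS
    fin_cases m <;> fin_cases n <;> simp only [Fin.sum_univ_three,
      Fin.zero_eta, Fin.mk_one, Fin.reduceFinMk,
      braiding_eq_outerSlice, outerSlice_braiding, Matrix.cons_val, Matrix.of_apply,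
      Matrix.zero_apply, h22, h12, h02, h01] <;> ring
  outer_mem S hS i l := by
    obtain ⟨h22, h12, h02, h01⟩ := mem_span_relMatrixB.1 hS
    rw [mem_span_relMatrixB]
    fin_cases i <;> fin_cases l <;> simp only [Fin.sum_univ_three,
      Fin.zero_eta, Fin.mk_one, Fin.reduceFinMk,
      outerSlice_braiding, Matrix.cons_val, Matrix.add_apply, Matrix.mul_apply,
      Matrix.transpose_apply, Matrix.of_apply, Matrix.zero_apply, h22, h12, h02, h01] <;>
      refine ⟨?_, ?_, ?_, ?_⟩ <;> ring
  inner_mem S hS n m := by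
    obtain ⟨h22, h12, h02, h01⟩ := mem_span_relMatrixB.1 hS
    rw [mem_span_relMatrixB]
    fin_cases n <;> fin_cases m <;> simp only [Fin.sum_univ_three,
      Fin.zero_eta, Fin.mk_one, Fin.reduceFinMk,
      innerSlice_braiding, Matrix.cons_val, Matrix.add_apply, Matrix.mul_apply,
      Matrix.transpose_apply, Matrix.of_apply, Matrix.zero_apply, h22, h12, h02, h01] <;>
      refine ⟨?_, ?_, ?_, ?_⟩ <;> ring

set_option maxHeartbeats 1000000 in
-- the three fields are settled by nine entrywise computations each
theorem isBraidedPrimitive_relMatrixC : IsBraidedPrimitive (braiding (-1) (-p) (-p ^ 2) d k ℓ p q)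
    (Submodule.span 𝕜 (Set.range (relMatrixC k ℓ p q))) where
  braiding_eq_neg S hS m n := by
    obtain ⟨h12, h02, h01⟩ := mem_span_relMatrixC.1 hS
    fin_cases m <;> fin_cases n <;> simp only [Fin.sum_univ_three,
      Fin.zero_eta, Fin.mk_one, Fin.reduceFinMk,
      braiding_eq_outerSlice, outerSlice_braiding, Matrix.cons_val, Matrix.of_apply,
      Matrix.zero_apply, h12, h02, h01] <;> ring
  outer_mem S hS i l := by
    obtain ⟨h12, h02, h01⟩ := mem_span_relMatrixC.1 hS
    rw [mem_span_relMatrixC]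
    fin_cases i <;> fin_cases l <;> simp only [Fin.sum_univ_three,
      Fin.zero_eta, Fin.mk_one, Fin.reduceFinMk,
      outerSlice_braiding, Matrix.cons_val, Matrix.add_apply, Matrix.mul_apply,
      Matrix.transpose_apply, Matrix.of_apply, Matrix.zero_apply, h12, h02, h01] <;>
      refine ⟨?_, ?_, ?_⟩ <;> ring
  inner_mem S hS n m := by
    obtain ⟨h12, h02, h01⟩ := mem_span_relMatrixC.1 hS
    rw [mem_span_relMatrixC]
    fin_cases n <;> fin_cases m <;> simp only [Fin.sum_univ_three,
      Fin.zero_eta, Fin.mk_one, Fin.reduceFinMk,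
      innerSlice_braiding, Matrix.cons_val, Matrix.add_apply, Matrix.mul_apply,
      Matrix.transpose_apply, Matrix.of_apply, Matrix.zero_apply, h12, h02, h01] <;>
      refine ⟨?_, ?_, ?_⟩ <;> ring

theorem isHopfIdeal_span_relA :
    IsHopfIdeal (braiding 1 (p - 2 * q) b d k ℓ p q) (TwoSidedIdeal.span (relA d k q)) := by
  rw [← quad_image_range_relMatrixA, ← quadIdeal_span]
  exact (isBraidedPrimitive_relMatrixA b d k ℓ p q).isHopfIdeal

theorem isHopfIdeal_span_relB :
    IsHopfIdeal (braiding (-1) (-p) b d k ℓ p q) (TwoSidedIdeal.span (relB k ℓ q)) := by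
  rw [← quad_image_range_relMatrixB, ← quadIdeal_span]
  exact (isBraidedPrimitive_relMatrixB b d k ℓ p q).isHopfIdeal

theorem isHopfIdeal_span_relC :
    IsHopfIdeal (braiding (-1) (-p) (-p ^ 2) d k ℓ p q) (TwoSidedIdeal.span (relC k ℓ p q)) := by
  rw [← quad_image_range_relMatrixC, ← quadIdeal_span]
  exact (isBraidedPrimitive_relMatrixC d k ℓ p q).isHopfIdeal

end Primitive

/-! ### The ordered monomials in the Nichols algebras of `ℜ_{1,7}` -/

section Relations

variable {A : Type*} [Ring A] [Algebra 𝕜 A]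

/-- The triple `y` satisfies the relations `relA`, solved for the products that are not ordered. -/
structure SatisfiesRelA (y : Fin 3 → A) (d k q : 𝕜) : Prop where
  one_zero : y 1 * y 0 = y 0 * y 1 + k • y 0 ^ 2
  two_zero : y 2 * y 0 = y 0 * y 2 + q • y 0 ^ 2
  two_one : y 2 * y 1 = y 1 * y 2 - k • (y 0 * y 2) + q • (y 0 * y 1) + (d + q * k) • y 0 ^ 2

/-- The triple `y` satisfies the relations `relB`, solved for the products that are not ordered
monomials with exponent in `expB1`. -/
structure SatisfiesRelB (y : Fin 3 → A) (k ℓ q : 𝕜) : Prop where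
  one_zero : y 1 * y 0 = -(y 0 * y 1)
  two_zero : y 2 * y 0 = -(y 0 * y 2)
  two_one : y 2 * y 1 = -(y 1 * y 2) + k • (y 0 * y 2) + q • (y 0 * y 1)
  zero_zero : y 0 * y 0 = 0
  one_one : y 1 * y 1 = ℓ • (y 0 * y 1)

/-- The triple `y` satisfies the relations `relC`, solved for the products that are not ordered
monomials with exponent in `expB0`. -/
structure SatisfiesRelC (y : Fin 3 → A) (k ℓ p q : 𝕜) : Prop extends SatisfiesRelB y k ℓ q where
  two_two : y 2 * y 2 = p • (y 0 * y 2)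

variable {φ : FreeAlgebra 𝕜 (Fin 3) →ₐ[𝕜] A} {d k ℓ p q : 𝕜}

theorem satisfiesRelA_of_map_eq_zero (h : ∀ s ∈ relA d k q, φ s = 0) :
    SatisfiesRelA (fun i => φ (x 𝕜 i)) d k q := by
  simp only [relA, Set.mem_insert_iff, Set.mem_singleton_iff, forall_eq_or_imp, forall_eq, map_sub,
    map_add, map_smul, map_mul, map_pow] at h
  obtain ⟨h1, h2, h3⟩ := h
  refine ⟨?_, ?_, ?_⟩ <;> rw [← sub_eq_zero]
  · rw [← h1]; abel
  · rw [← h2]; abel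
  · rw [← h3]; abel

theorem satisfiesRelB_of_map_eq_zero (h : ∀ s ∈ relB k ℓ q, φ s = 0) :
    SatisfiesRelB (fun i => φ (x 𝕜 i)) k ℓ q := by
  simp only [relB, Set.mem_insert_iff, Set.mem_singleton_iff, forall_eq_or_imp, forall_eq, map_sub,
    map_add, map_smul, map_mul, pow_two] at h
  obtain ⟨h1, h2, h3, h4, h5⟩ := h
  refine ⟨eq_neg_of_add_eq_zero_left h1, eq_neg_of_add_eq_zero_left h2, ?_, h4, sub_eq_zero.1 h5⟩
  rw [← sub_eq_zero, ← h3]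
  abel

theorem satisfiesRelC_of_map_eq_zero (h : ∀ s ∈ relC k ℓ p q, φ s = 0) :
    SatisfiesRelC (fun i => φ (x 𝕜 i)) k ℓ p q where
  toSatisfiesRelB := satisfiesRelB_of_map_eq_zero fun s hs => h s (Or.inl hs)
  two_two := by
    have h6 := h _ (Or.inr rfl)
    simp only [map_sub, map_smul, map_mul, pow_two] at h6
    exact sub_eq_zero.1 h6

theorem gen_satisfiesRelB (b d k ℓ p q : 𝕜) :
    SatisfiesRelB (gen (braiding (-1) (-p) b d k ℓ p q)) k ℓ q :=
  satisfiesRelB_of_map_eq_zero (φ := proj _) fun _ hs => (proj_eq_zero_iff _).2 <|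
    (nicholsIdeal_isGreatest _).2 (isHopfIdeal_span_relB b d k ℓ p q)
      (TwoSidedIdeal.subset_span hs)

end Relations

section Family

variable (t a b d k ℓ p q : 𝕜)

local notation "Q" => NicholsAlgebra (braiding t a b d k ℓ p q)
local notation "y" => gen (braiding t a b d k ℓ p q)
local notation "∂" => nicholsDer (braiding t a b d k ℓ p q)

theorem nicholsDer_gen_mul_of_lt {i l : Fin 3} (hil : i < l) (f : Q) :
    ∂ l (y i * f) = y i * ∂ l f :=
  nicholsDer_gen_mul (braiding_eq_zero_of_lt t a b d k ℓ p q) hil f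

theorem nicholsDer_two_mul_gen_zero (f : Q) : ∂ 2 (f * y 0) = ∂ 2 f * t • y 0 := by
  simp only [nicholsDer_mul_gen, Fin.sum_univ_three]
  simp [braiding, RMatrix]

theorem nicholsDer_one_mul_gen_zero (f : Q) : ∂ 1 (f * y 0) = ∂ 1 f * t • y 0 := by
  simp only [nicholsDer_mul_gen, Fin.sum_univ_three]
  simp [braiding, RMatrix]

theorem nicholsDer_zero_mul_gen_zero {f : Q} (h1 : ∂ 1 f = 0) (h2 : ∂ 2 f = 0) :
    ∂ 0 (f * y 0) = f + ∂ 0 f * t • y 0 := by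
  simp only [nicholsDer_mul_gen, Fin.sum_univ_three]
  simp [braiding, RMatrix, h1, h2]

theorem nicholsDer_two_mul_gen_two (f : Q) :
    ∂ 2 (f * y 2) = f + ∂ 2 f * (t • y 2 + (t * a) • y 0) := by
  simp only [nicholsDer_mul_gen, Fin.sum_univ_three]
  simp [braiding, RMatrix, add_comm]

theorem nicholsDer_one_mul_gen_two (f : Q) :
    ∂ 1 (f * y 2) = ∂ 1 f * (t • y 2 + (t * a) • y 0) := by
  simp only [nicholsDer_mul_gen, Fin.sum_univ_three]
  simp [braiding, RMatrix, add_comm]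

theorem nicholsDer_zero_mul_gen_two {f : Q} (h1 : ∂ 1 f = 0) :
    ∂ 0 (f * y 2) = ∂ 0 f * (t • y 2 + (t * a) • y 0) +
      ∂ 2 f * ((t * p) • y 2 + (t * b) • y 0) := by
  simp only [nicholsDer_mul_gen, Fin.sum_univ_three]
  simp [braiding, RMatrix, h1, add_comm]

end Family

section One

variable (a b d k ℓ p q : 𝕜)

local notation "y" => gen (braiding 1 a b d k ℓ p q)
local notation "∂" => nicholsDer (braiding 1 a b d k ℓ p q)

theorem nicholsDer_pow_gen_pow (j : Fin 3) (n : ℕ) :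
    (∂ j ^ n) (y j ^ n) = (n.factorial : 𝕜) • 1 := by
  have hr := braiding_eq_zero_of_lt 1 a b d k ℓ p q
  have hstable {f} (hf : f ∈ Algebra.adjoin 𝕜 (y '' Set.Iic j)) :
      ∂ j f ∈ Algebra.adjoin 𝕜 (y '' Set.Iic j) :=
    nicholsDer_mem_adjoin (fun i m hm m' hm' l =>
      braiding_eq_zero_of_le_of_lt 1 a b d k ℓ p q j i m m' l hm (not_le.1 hm')) j hf
  have hgen : y j ∈ Algebra.adjoin 𝕜 (y '' Set.Iic j) :=
    Algebra.subset_adjoin (Set.mem_image_of_mem _ Set.self_mem_Iic)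
  refine pow_apply_pow (w := (![0, -ℓ, a] : Fin 3 → 𝕜) j • y 0) (nicholsDer_one _ _) hgen
    (fun f => hstable) (fun f hf => ?_) (fun f hf => ?_) n
  · rw [nicholsDer_mul_gen_of_mem_adjoin hr hf, if_pos rfl]
    fin_cases j <;>
      simp [Fin.sum_univ_three, braiding, RMatrix, add_comm]
  · rw [mul_smul_comm, map_smul, nicholsDer_mul_gen_of_mem_adjoin hr hf, mul_smul_comm]
    fin_cases j <;>
      simp [Fin.sum_univ_three, braiding, RMatrix]

theorem linearIndepOn_expB3 [CharZero 𝕜] : LinearIndepOn 𝕜 (orderedMonomial y) expB3 := by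
  refine (linearIndepOn_orderedMonomial (D := ∂) (s := Set.univ) (c := fun n => n.factorial)
    (fun n _ => Nat.cast_ne_zero.2 n.factorial_ne_zero)
    (fun i j => nicholsDer_gen_mul_of_lt 1 a b d k ℓ p q) (nicholsDer_one _)
    fun j n _ => nicholsDer_pow_gen_pow a b d k ℓ p q j n).mono fun e _ i => Set.mem_univ _

end One

theorem linearIndepOn_expB0 (t a b d k ℓ p q : 𝕜) :
    LinearIndepOn 𝕜 (orderedMonomial (gen (braiding t a b d k ℓ p q))) expB0 := by
  refine linearIndepOn_orderedMonomial (s := {n | n < 2}) (c := 1) (fun _ _ => one_ne_zero)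
    (fun i j => nicholsDer_gen_mul_of_lt t a b d k ℓ p q) (nicholsDer_one _) fun j n hn => ?_
  obtain rfl | rfl : n = 0 ∨ n = 1 := by have : n < 2 := hn; lia
  · simp
  · have h := nicholsDer_mul_gen (braiding t a b d k ℓ p q) j j 1
    simpa [nicholsDer_one] using h

section MinusOne

variable (b d k ℓ p q : 𝕜)

local notation "Q" => NicholsAlgebra (braiding (-1) (-p) b d k ℓ p q)
local notation "y" => gen (braiding (-1) (-p) b d k ℓ p q)
local notation "∂" => nicholsDer (braiding (-1) (-p) b d k ℓ p q)

/-- The element `x₃² - p x₁x₃` of the Nichols algebra: case (c) makes it a relation, while in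
case (b) its powers account for the Gelfand–Kirillov dimension. -/
def sqDefect : Q := (y 2 - p • y 0) * y 2

local notation "z" => sqDefect b d k ℓ p q

theorem gen_zero_mul_gen_zero : y 0 * y 0 = 0 := (gen_satisfiesRelB b d k ℓ p q).zero_zero

theorem gen_one_mul_gen_zero : y 1 * y 0 = -(y 0 * y 1) := (gen_satisfiesRelB b d k ℓ p q).one_zero

theorem gen_two_mul_gen_zero : y 2 * y 0 = -(y 0 * y 2) := (gen_satisfiesRelB b d k ℓ p q).two_zero

theorem nicholsDer_two_mul_gen_two' (f : Q) : ∂ 2 (f * y 2) = f - ∂ 2 f * (y 2 - p • y 0) := by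
  rw [nicholsDer_two_mul_gen_two]
  simp only [mul_add, mul_sub, mul_smul_comm]
  module

theorem nicholsDer_one_mul_gen_two' (f : Q) : ∂ 1 (f * y 2) = -(∂ 1 f * (y 2 - p • y 0)) := by
  rw [nicholsDer_one_mul_gen_two]
  simp only [mul_add, mul_sub, mul_smul_comm]
  module

theorem nicholsDer_two_mul_sub (f : Q) :
    ∂ 2 (f * (y 2 - p • y 0)) = f - ∂ 2 f * (y 2 - (2 * p) • y 0) := by
  rw [mul_sub, map_sub, nicholsDer_two_mul_gen_two', mul_smul_comm, map_smul,
    nicholsDer_two_mul_gen_zero]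
  simp only [mul_sub, mul_smul_comm]
  module

theorem nicholsDer_one_mul_sub (f : Q) :
    ∂ 1 (f * (y 2 - p • y 0)) = -(∂ 1 f * (y 2 - (2 * p) • y 0)) := by
  rw [mul_sub, map_sub, nicholsDer_one_mul_gen_two', mul_smul_comm, map_smul,
    nicholsDer_one_mul_gen_zero]
  simp only [mul_sub, mul_smul_comm]
  module

theorem nicholsDer_zero_mul_sub {f : Q} (h1 : ∂ 1 f = 0) (h2 : ∂ 2 f = 0) :
    ∂ 0 (f * (y 2 - p • y 0)) = -(∂ 0 f * (y 2 - (2 * p) • y 0)) - p • f := by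
  rw [mul_sub, map_sub, nicholsDer_zero_mul_gen_two (-1) (-p) b d k ℓ p q h1, h2, zero_mul,
    mul_smul_comm, map_smul, nicholsDer_zero_mul_gen_zero (-1) (-p) b d k ℓ p q h1 h2]
  simp only [mul_sub, mul_add, mul_smul_comm]
  module

theorem sub_mul_sub_eq_sqDefect : (y 2 - (2 * p) • y 0) * (y 2 - p • y 0) = z := by
  simp only [sqDefect, mul_sub, sub_mul, mul_smul_comm, smul_mul_assoc, gen_zero_mul_gen_zero,
    gen_two_mul_gen_zero]
  module

theorem nicholsDer_two_mul_sqDefect (f : Q) : ∂ 2 (f * z) = ∂ 2 f * z := by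
  rw [sqDefect, ← mul_assoc, nicholsDer_two_mul_gen_two', nicholsDer_two_mul_sub, sub_mul,
    sub_sub_cancel, mul_assoc, sub_mul_sub_eq_sqDefect b d k ℓ p q, sqDefect]

theorem nicholsDer_one_mul_sqDefect (f : Q) : ∂ 1 (f * z) = ∂ 1 f * z := by
  rw [sqDefect, ← mul_assoc, nicholsDer_one_mul_gen_two', nicholsDer_one_mul_sub, neg_mul, neg_neg,
    mul_assoc, sub_mul_sub_eq_sqDefect b d k ℓ p q, sqDefect]

theorem nicholsDer_zero_mul_sqDefect {f : Q} (hf1 : ∂ 1 f = 0) (hf2 : ∂ 2 f = 0) :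
    ∂ 0 (f * z) = ∂ 0 f * z - (b + p ^ 2) • (f * y 0) := by
  have hs1 : ∂ 1 (f * (y 2 - p • y 0)) = 0 := by
    rw [nicholsDer_one_mul_sub, hf1, zero_mul, neg_zero]
  have hs2 : ∂ 2 (f * (y 2 - p • y 0)) = f := by
    rw [nicholsDer_two_mul_sub, hf2, zero_mul, sub_zero]
  have huz : ∂ 0 f * (y 2 - (2 * p) • y 0) * (y 2 - p • y 0) = ∂ 0 f * z := by
    rw [mul_assoc, sub_mul_sub_eq_sqDefect b d k ℓ p q]
  rw [sqDefect, ← mul_assoc, nicholsDer_zero_mul_gen_two (-1) (-p) b d k ℓ p q hs1, hs2,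
    nicholsDer_zero_mul_sub b d k ℓ p q hf1 hf2, ← sqDefect, ← huz]
  simp only [mul_add, mul_sub, sub_mul, neg_mul, mul_smul_comm, smul_mul_assoc]
  module

theorem commute_sqDefect_gen_zero : Commute z (y 0) := by
  have h0' (f : Q) : y 0 * (y 0 * f) = 0 := by rw [← mul_assoc, gen_zero_mul_gen_zero, zero_mul]
  have h2' (f : Q) : y 2 * (y 0 * f) = -(y 0 * (y 2 * f)) := by
    rw [← mul_assoc, gen_two_mul_gen_zero, neg_mul, mul_assoc]
  simp [Commute, SemiconjBy, sqDefect, sub_mul, mul_sub, mul_assoc, gen_two_mul_gen_zero, h0', h2']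

theorem nicholsDer_two_mul_sqDefect_pow (f : Q) (m : ℕ) : ∂ 2 (f * z ^ m) = ∂ 2 f * z ^ m := by
  induction m with
  | zero => simp
  | succ m ih => rw [pow_succ, ← mul_assoc, nicholsDer_two_mul_sqDefect b d k ℓ p q, ih, mul_assoc]

theorem nicholsDer_one_mul_sqDefect_pow (f : Q) (m : ℕ) : ∂ 1 (f * z ^ m) = ∂ 1 f * z ^ m := by
  induction m with
  | zero => simp
  | succ m ih => rw [pow_succ, ← mul_assoc, nicholsDer_one_mul_sqDefect b d k ℓ p q, ih, mul_assoc]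

theorem nicholsDer_zero_mul_sqDefect_pow {f : Q} (hf1 : ∂ 1 f = 0) (hf2 : ∂ 2 f = 0) (m : ℕ) :
    ∂ 0 (f * z ^ m) = ∂ 0 f * z ^ m - (m * (b + p ^ 2)) • (f * y 0 * z ^ (m - 1)) := by
  induction m with
  | zero => simp
  | succ m ih =>
    rw [pow_succ, ← mul_assoc, nicholsDer_zero_mul_sqDefect b d k ℓ p q
      (by rw [nicholsDer_one_mul_sqDefect_pow b d k ℓ p q, hf1, zero_mul])
      (by rw [nicholsDer_two_mul_sqDefect_pow b d k ℓ p q, hf2, zero_mul]), ih,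
      mul_assoc f (z ^ m), ((commute_sqDefect_gen_zero b d k ℓ p q).pow_left m).eq,
      Nat.add_sub_cancel]
    cases m with
    | zero => simp
    | succ m =>
      simp only [sub_mul, smul_mul_assoc, mul_assoc, ← pow_succ, Nat.add_sub_cancel]
      push_cast
      module

theorem nicholsDer_zero_gen_zero_mul_sqDefect_pow (m : ℕ) : ∂ 0 (y 0 * z ^ m) = z ^ m := by
  rw [nicholsDer_zero_mul_sqDefect_pow b d k ℓ p q (by simp [nicholsDer_gen])
    (by simp [nicholsDer_gen]), gen_zero_mul_gen_zero, zero_mul, smul_zero, sub_zero,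
    nicholsDer_gen, if_pos rfl, one_mul]

theorem nicholsDer_zero_sq_pow_sqDefect_pow (m : ℕ) :
    ((∂ 0 ^ 2) ^ m) (z ^ m) = (m.factorial * (-(b + p ^ 2)) ^ m : 𝕜) • 1 := by
  have hstep (m : ℕ) : (∂ 0 ^ 2) (z ^ (m + 1)) = ((m + 1) * -(b + p ^ 2) : 𝕜) • z ^ m := by
    have h := nicholsDer_zero_mul_sqDefect_pow b d k ℓ p q (nicholsDer_one _ 1) (nicholsDer_one _ 2)
      (m + 1)
    rw [one_mul, one_mul, nicholsDer_one, zero_mul, zero_sub, Nat.add_sub_cancel] at h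
    rw [pow_two, Module.End.mul_apply, h, map_neg, map_smul,
      nicholsDer_zero_gen_zero_mul_sqDefect_pow b d k ℓ p q]
    push_cast
    module
  induction m with
  | zero => simp
  | succ m ih =>
    rw [pow_succ, Module.End.mul_apply, hstep, map_smul, ih, smul_smul, Nat.factorial_succ]
    push_cast
    ring_nf

theorem mul_sq_pow_eq_mul_sqDefect_pow {f : Q} (hf : f * y 0 = 0) (m : ℕ) :
    f * (y 2 * y 2) ^ m = f * z ^ m := by
  induction m with
  | zero => simp
  | succ m ih =>
    have hfz : f * z ^ m * y 0 = 0 := by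
      rw [mul_assoc, ((commute_sqDefect_gen_zero b d k ℓ p q).pow_left m).eq, ← mul_assoc, hf,
        zero_mul]
    calc f * (y 2 * y 2) ^ (m + 1) = f * z ^ m * (y 2 * y 2) := by rw [pow_succ, ← mul_assoc, ih]
      _ = f * z ^ m * (y 2 - p • y 0) * y 2 := by
        rw [mul_sub, mul_smul_comm, hfz, smul_zero, sub_zero, mul_assoc (f * z ^ m)]
      _ = f * z ^ (m + 1) := by rw [pow_succ, mul_assoc _ _ (y 2), mul_assoc f]; rfl

theorem linearIndependent_gen_zero_mul_sqDefect_pow [CharZero 𝕜] (hb : b ≠ -p ^ 2) :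
    LinearIndependent 𝕜 fun m : ℕ => y 0 * z ^ m := by
  have hb' : -(b + p ^ 2) ≠ 0 := neg_ne_zero.2 fun h => hb (eq_neg_of_add_eq_zero_left h)
  have hz : LinearIndepOn 𝕜 (fun x : ℕ × Unit => (1 : Q) * z ^ x.1) (Set.univ ×ˢ Set.univ) :=
    linearIndepOn_mul_pow_of_lowering (v := fun _ : Unit => (1 : Q)) (D := ∂ 0 ^ 2)
      (c := fun m => m.factorial * (-(b + p ^ 2)) ^ m) (by simp)
      (fun _ f => by rw [one_mul, one_mul]) (by simp [pow_two, nicholsDer_one])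
      (fun m _ => mul_ne_zero (Nat.cast_ne_zero.2 m.factorial_ne_zero) (pow_ne_zero m hb'))
      fun m _ => nicholsDer_zero_sq_pow_sqDefect_pow b d k ℓ p q m
  rw [Set.univ_prod_univ, linearIndepOn_univ_iff] at hz
  refine LinearIndependent.of_comp (∂ 0) ?_
  have hcomp : (∂ 0 : Q → Q) ∘ (fun m : ℕ => y 0 * z ^ m) =
      (fun x : ℕ × Unit => (1 : Q) * z ^ x.1) ∘ fun m => (m, ()) := funext fun m => by
    simp only [Function.comp_apply, one_mul, nicholsDer_zero_gen_zero_mul_sqDefect_pow b d k ℓ p q]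
  rw [hcomp]
  exact hz.comp (fun m => (m, ())) (fun m m' h => congrArg Prod.fst h)

theorem linearIndepOn_gen_zero_mul_pow_mul_sqDefect_pow [CharZero 𝕜] (hb : b ≠ -p ^ 2) :
    LinearIndepOn 𝕜 (fun x : ℕ × ℕ × ℕ => y 0 * y 1 ^ x.2.1 * z ^ x.2.2 * y 2 ^ x.1)
      ({n | n < 2} ×ˢ {n | n < 2} ×ˢ Set.univ) := by
  have hr {i l : Fin 3} (hil : i < l) (f : Q) : ∂ l (y i * f) = y i * ∂ l f :=
    nicholsDer_gen_mul_of_lt (-1) (-p) b d k ℓ p q hil f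
  have hone : LinearIndepOn 𝕜 (fun x : ℕ × ℕ => y 0 * y 1 ^ x.1 * z ^ x.2)
      ({n | n < 2} ×ˢ Set.univ) := by
    refine linearIndepOn_prod_of_lowering_two (D := ∂ 1)
      (linearIndepOn_univ_iff.2 (linearIndependent_gen_zero_mul_sqDefect_pow b d k ℓ p q hb))
      (fun m _ => by simp) (fun m _ => ?_) (fun m _ => ?_) <;>
    rw [nicholsDer_one_mul_sqDefect_pow b d k ℓ p q]
    · rw [pow_one, hr (by decide), nicholsDer_gen, if_pos rfl, mul_one]
    · rw [nicholsDer_gen, if_neg (by decide), zero_mul]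
  have hkill (β m : ℕ) : ∂ 2 (y 0 * y 1 ^ β * z ^ m) = 0 := by
    rw [nicholsDer_two_mul_sqDefect_pow b d k ℓ p q, hr (by decide),
      nicholsDer_eq_zero_of_mem_adjoin (braiding_eq_zero_of_lt (-1) (-p) b d k ℓ p q)
        (pow_mem (Algebra.subset_adjoin (Set.mem_image_of_mem _ (by decide))) β), mul_zero,
      zero_mul]
  refine linearIndepOn_prod_of_lowering_two (D := ∂ 2) hone (fun x _ => by simp)
    (fun x _ => ?_) (fun x _ => hkill x.1 x.2)
  rw [pow_one, nicholsDer_two_mul_gen_two', hkill, zero_mul, sub_zero]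

theorem gen_zero_mul_gen_one_pow_mul_gen_zero (n : ℕ) : y 0 * y 1 ^ n * y 0 = 0 := by
  induction n with
  | zero => rw [pow_zero, mul_one, gen_zero_mul_gen_zero]
  | succ n ih =>
    rw [pow_succ, ← mul_assoc, mul_assoc _ (y 1), gen_one_mul_gen_zero, mul_neg, ← mul_assoc, ih,
      zero_mul, neg_zero]

theorem linearIndepOn_expB1 [CharZero 𝕜] (hb : b ≠ -p ^ 2) :
    LinearIndepOn 𝕜 (orderedMonomial y) expB1 := by
  have hleft : LinearIndepOn 𝕜
      (fun x : ℕ × ℕ × ℕ × ℕ =>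
        y 0 ^ (1 - x.1) * (y 1 ^ x.2.2.1 * (y 2 * y 2) ^ x.2.2.2 * y 2 ^ x.2.1))
      ({n | n < 2} ×ˢ {n | n < 2} ×ˢ {n | n < 2} ×ˢ Set.univ) := by
    have hsq (x : ℕ × ℕ × ℕ) : y 0 * (y 1 ^ x.2.1 * (y 2 * y 2) ^ x.2.2 * y 2 ^ x.1) =
        y 0 * y 1 ^ x.2.1 * z ^ x.2.2 * y 2 ^ x.1 := by
      rw [← mul_assoc, ← mul_assoc, mul_sq_pow_eq_mul_sqDefect_pow b d k ℓ p q
        (gen_zero_mul_gen_one_pow_mul_gen_zero b d k ℓ p q _)]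
    refine linearIndepOn_prod_of_lowering_two (D := LinearMap.mulLeft 𝕜 (y 0))
      (linearIndepOn_gen_zero_mul_pow_mul_sqDefect_pow b d k ℓ p q hb) (fun x _ => ?_)
      (fun x _ => ?_) (fun x _ => ?_)
    · rw [Nat.sub_zero, pow_one, hsq]
    · rw [Nat.sub_self, pow_zero, one_mul, LinearMap.mulLeft_apply, hsq]
    · simp only [LinearMap.mulLeft_apply, ← mul_assoc, gen_zero_mul_gen_zero, zero_mul]
  let φ : (Fin 3 → ℕ) → ℕ × ℕ × ℕ × ℕ := fun e => (1 - e 0, e 2 % 2, e 1, e 2 / 2)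
  have hφ : Set.InjOn φ expB1 := by
    intro e he e' he' h
    simp only [φ, Prod.mk.injEq] at h
    have h0 : e 0 < 2 := he.1
    have h0' : e' 0 < 2 := he'.1
    ext i
    fin_cases i <;> dsimp only [Fin.zero_eta, Fin.mk_one, Fin.reduceFinMk] <;> lia
  have himage : φ '' expB1 ⊆ {n | n < 2} ×ˢ {n | n < 2} ×ˢ {n | n < 2} ×ˢ Set.univ := by
    rintro _ ⟨e, he, rfl⟩
    exact ⟨Nat.lt_succ_of_le (Nat.sub_le 1 _), Nat.mod_lt _ two_pos, he.2, trivial⟩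
  refine ((hleft.mono himage).comp_of_image hφ).congr fun e he => ?_
  have he0 : 1 - (1 - e 0) = e 0 := by have : e 0 < 2 := he.1; lia
  simp only [Function.comp_apply, φ, orderedMonomial, he0, ← pow_two, ← pow_mul, mul_assoc,
    ← pow_add, Nat.div_add_mod]

end MinusOne

section Straightening

variable {A : Type*} [Ring A] [Algebra 𝕜 A] {y : Fin 3 → A} {d k ℓ p q : 𝕜}
  {E : Set (Fin 3 → ℕ)}

theorem SatisfiesRelA.straightens (h : SatisfiesRelA y d k q) : Straightens 𝕜 y expB3 := by
  have hmem {i j l N : ℕ} (hN : i + j + l ≤ N) :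
      y 0 ^ i * (y 1 ^ j * y 2 ^ l) ∈ monomialSpan 𝕜 y expB3 N :=
    pow_mul_pow_mul_pow_mem_monomialSpan (Set.mem_univ _) hN
  refine straightens_of_triangular (α₁ := 1) (β₁ := k) (α₂ := 1) (β₂ := q) (α := 1) (β := -k)
    (γ := q) (δ := d + q * k) (Set.mem_univ _) isLowerSet_univ ?_ ?_ ?_
    (fun i j l _ => hmem (by lia)) (fun j l _ => ?_) (fun l _ => ?_)
  · rw [h.one_zero, one_smul, pow_two]
  · rw [h.two_zero, one_smul, pow_two]
  · rw [h.two_one, one_smul, pow_two, neg_smul, sub_eq_add_neg]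
  · simpa using hmem (i := 0) (j := j + 1) (l := l) (by lia)
  · simpa using hmem (i := 0) (j := 0) (l := l + 1) (by lia)

theorem SatisfiesRelB.straightens (h : SatisfiesRelB y k ℓ q) {C : Set ℕ}
    (hE : ∀ i j l, ![i, j, l] ∈ E ↔ i < 2 ∧ j < 2 ∧ l ∈ C) (hzero : 0 ∈ E) (hlower : IsLowerSet E)
    (hpow : ∀ l ∈ C, y 2 ^ (l + 1) ∈ monomialSpan 𝕜 y E (l + 1)) : Straightens 𝕜 y E := by
  have hmem {i j l N : ℕ} (hi : i < 2) (hj : j < 2) (hl : l ∈ C) (hN : i + j + l ≤ N) :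
      y 0 ^ i * (y 1 ^ j * y 2 ^ l) ∈ monomialSpan 𝕜 y E N :=
    pow_mul_pow_mul_pow_mem_monomialSpan ((hE i j l).2 ⟨hi, hj, hl⟩) hN
  refine straightens_of_triangular (α₁ := -1) (β₁ := 0) (α₂ := -1) (β₂ := 0) (α := -1) (β := k)
    (γ := q) (δ := 0) hzero hlower ?_ ?_ ?_ ?_ ?_ fun l hl => hpow l ((hE 0 0 l).1 hl).2.2
  · rw [h.one_zero]; simp
  · rw [h.two_zero]; simp
  · rw [h.two_one]; simp
  · intro i j l he
    obtain ⟨hi, hj, hl⟩ := (hE i j l).1 he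
    interval_cases i
    · exact hmem (by lia) hj hl (by lia)
    · rw [pow_two, h.zero_zero, zero_mul]
      exact zero_mem _
  · intro j l he
    obtain ⟨-, hj, hl⟩ := (hE 0 j l).1 he
    interval_cases j
    · simpa using hmem (i := 0) (j := 1) (l := l) (N := l + 0 + 1) (by lia) (by lia) hl (by lia)
    · rw [pow_two, h.one_one, smul_mul_assoc]
      refine Submodule.smul_mem _ _ ?_
      simpa [mul_assoc] using
        hmem (i := 1) (j := 1) (l := l) (N := l + 1 + 1) (by lia) (by lia) hl (by lia)

theorem SatisfiesRelB.straightens_expB1 (h : SatisfiesRelB y k ℓ q) : Straightens 𝕜 y expB1 := by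
  refine h.straightens (C := Set.univ) (fun i j l => by simp [expB1]) (by simp [expB1])
    (fun e e' hle he => ⟨(hle 0).trans_lt he.1, (hle 1).trans_lt he.2⟩) fun l _ => ?_
  simpa using pow_mul_pow_mul_pow_mem_monomialSpan (𝕜 := 𝕜) (y := y) (E := expB1)
    (i := 0) (j := 0) (l := l + 1) (by simp [expB1]) (N := l + 1) (by lia)

theorem SatisfiesRelC.straightens_expB0 (h : SatisfiesRelC y k ℓ p q) :
    Straightens 𝕜 y expB0 := by
  have hmem {i l : ℕ} (hi : i < 2) (hl : l < 2) :
      y 0 ^ i * y 2 ^ l ∈ monomialSpan 𝕜 y expB0 (i + l) := by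
    simpa using pow_mul_pow_mul_pow_mem_monomialSpan (𝕜 := 𝕜) (y := y) (E := expB0)
      (i := i) (j := 0) (l := l) (forall_fin_three.2 ⟨hi, two_pos, hl⟩) (N := i + l) (by lia)
  refine h.toSatisfiesRelB.straightens (C := {l | l < 2})
    (fun i j l => by simp [expB0, forall_fin_three]) (by simp [expB0])
    (fun e e' hle he i => (hle i).trans_lt (he i)) fun l hl => ?_
  obtain rfl | rfl : l = 0 ∨ l = 1 := by have : l < 2 := hl; lia
  · simpa using hmem (i := 0) (l := 1) (by lia) (by lia)
  · rw [pow_two, h.two_two]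
    exact Submodule.smul_mem _ _ (by simpa using hmem (i := 1) (l := 1) (by lia) (by lia))

end Straightening

section NicholsAlgebra

variable (b d k ℓ p q : 𝕜)

theorem nicholsAlgebra_one [CharZero 𝕜] :
    nicholsIdeal (braiding 1 (p - 2 * q) b d k ℓ p q) = TwoSidedIdeal.span (relA d k q) ∧
      IsMonomialBasis (braiding 1 (p - 2 * q) b d k ℓ p q) expB3 ∧
      gkDim 𝕜 (NicholsAlgebra (braiding 1 (p - 2 * q) b d k ℓ p q)) = (3 : ℕ) :=
  nicholsIdeal_eq_and_isMonomialBasis_and_gkDim_eq (isHopfIdeal_span_relA b d k ℓ p q)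
    (fun _ hI => (satisfiesRelA_of_map_eq_zero hI).straightens)
    (linearIndepOn_expB3 (p - 2 * q) b d k ℓ p q)
    one_pos ncard_degreeLE_expB3_le (by norm_num) le_ncard_degreeLE_expB3

theorem nicholsAlgebra_neg_one_of_ne [CharZero 𝕜] (hb : b ≠ -p ^ 2) :
    nicholsIdeal (braiding (-1) (-p) b d k ℓ p q) = TwoSidedIdeal.span (relB k ℓ q) ∧
      IsMonomialBasis (braiding (-1) (-p) b d k ℓ p q) expB1 ∧
      gkDim 𝕜 (NicholsAlgebra (braiding (-1) (-p) b d k ℓ p q)) = (1 : ℕ) :=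
  nicholsIdeal_eq_and_isMonomialBasis_and_gkDim_eq (isHopfIdeal_span_relB b d k ℓ p q)
    (fun _ hI => (satisfiesRelB_of_map_eq_zero hI).straightens_expB1)
    (linearIndepOn_expB1 b d k ℓ p q hb)
    four_pos ncard_degreeLE_expB1_le one_pos le_ncard_degreeLE_expB1

theorem nicholsAlgebra_neg_one_of_eq :
    nicholsIdeal (braiding (-1) (-p) (-p ^ 2) d k ℓ p q) = TwoSidedIdeal.span (relC k ℓ p q) ∧
      IsMonomialBasis (braiding (-1) (-p) (-p ^ 2) d k ℓ p q) expB0 ∧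
      gkDim 𝕜 (NicholsAlgebra (braiding (-1) (-p) (-p ^ 2) d k ℓ p q)) = (0 : ℕ) :=
  nicholsIdeal_eq_and_isMonomialBasis_and_gkDim_eq (isHopfIdeal_span_relC d k ℓ p q)
    (fun _ hI => (satisfiesRelC_of_map_eq_zero hI).straightens_expB0)
    (linearIndepOn_expB0 (-1) (-p) (-p ^ 2) d k ℓ p q)
    (by norm_num) ncard_degreeLE_expB0_le one_pos le_ncard_degreeLE_expB0

end NicholsAlgebra

end R17

end

theorem proposition3p13 {𝕜 : Type*} [Field 𝕜] [CharZero 𝕜] (t a b d k ℓ p q : 𝕜) :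
    (t = 1 → a = p - 2 * q →
      Nichols.nicholsIdeal (R17.braiding t a b d k ℓ p q) =
          TwoSidedIdeal.span (R17.relA d k q) ∧
        Nichols.IsMonomialBasis (R17.braiding t a b d k ℓ p q) Nichols.expB3 ∧
        gkDim 𝕜 (Nichols.NicholsAlgebra (R17.braiding t a b d k ℓ p q)) = 3) ∧
    (t = -1 → a = -p → b ≠ -p ^ 2 →
      Nichols.nicholsIdeal (R17.braiding t a b d k ℓ p q) =
          TwoSidedIdeal.span (R17.relB k ℓ q) ∧
        Nichols.IsMonomialBasis (R17.braiding t a b d k ℓ p q) Nichols.expB1 ∧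
        gkDim 𝕜 (Nichols.NicholsAlgebra (R17.braiding t a b d k ℓ p q)) = 1) ∧
    (t = -1 → a = -p → b = -p ^ 2 →
      Nichols.nicholsIdeal (R17.braiding t a b d k ℓ p q) =
          TwoSidedIdeal.span (R17.relC k ℓ p q) ∧
        Nichols.IsMonomialBasis (R17.braiding t a b d k ℓ p q) Nichols.expB0 ∧
        gkDim 𝕜 (Nichols.NicholsAlgebra (R17.braiding t a b d k ℓ p q)) = 0 ∧
        Module.finrank 𝕜 (Nichols.NicholsAlgebra (R17.braiding t a b d k ℓ p q)) = 8) := by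
  refine ⟨?_, ?_, ?_⟩
  · rintro rfl rfl
    exact R17.nicholsAlgebra_one b d k ℓ p q
  · rintro rfl rfl hb
    simpa using R17.nicholsAlgebra_neg_one_of_ne b d k ℓ p q hb
  · rintro rfl rfl rfl
    obtain ⟨hideal, hbasis, hgk⟩ := R17.nicholsAlgebra_neg_one_of_eq d k ℓ p q
    exact ⟨hideal, hbasis, by simpa using hgk, Nichols.finrank_of_isMonomialBasis_expB0 hbasis⟩
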